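/- Let $\mathbb K$ be a field of characteristic $0$; all vector spaces, algebras and tensor products are over $\mathbb K$. **Notation.** Let $\mathbf{NA}$ be the category of finite dimensional, nilpotent, associative, graded-commutative, differential $\mathbb Z$-graded algebras $A=\bigoplus_i A_i$ (without unit; $d(A_i)\subset A_{i+1}$; nilpotent means $A^n=0$ for $n\gg0$), with morphisms the degree-preserving algebra maps commuting with $d$. Let $\mathbf{NA}\cap\mathbf{DG}$ be the full subcategory of those $A$ with $A\cdot A=0$. An *acyclic small extension* is a surjective morphism $\alpha\colon A\to B$ in $\mathbf{NA}$ such that $A\cdot\ker\alpha=0$ and the complex $\ker\alpha$ is acyclic. A functor $F\colon\mathbf{NA}\to\mathbf{Set}$ is a *predeformation functor* if 1. $F(0)$ is a one-point set; 2. for all morphisms $\alpha\colon A\to C$, $\beta\colon B\to C$ with $\alpha$ surjective, the map $\eta\colon F(A\times_CB)\to F(A)\times_{F(C)}F(B)$ is surjective, and it is bijective if moreover $C\in\mathbf{NA}\cap\mathbf{DG}$ is acyclic; 3. $F(A)\to F(B)$ is surjective for every acyclic small extension $A\to B$. It is a *deformation functor* if, in addition, $F(I)$ is a one-point set for every acyclic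 $I\in\mathbf{NA}\cap\mathbf{DG}$. For a predeformation functor $F$ and $A\in\mathbf{NA}\cap\mathbf{DG}$, the set $F(A)$ is a vector space, with sum $F(A)\times F(A)\cong F(A\times A)\to F(A)$ induced by $+\colon A\times A\to A$ and scalar multiplication induced by the maps $s\cdot\colon A\to A$, $s\in\mathbb K$. Let $\mathbb K[n]$ be $\mathbb K$ in degree $-n$, generated by $1[n]$, and let $\Omega[n]$ be the acyclic complex $\mathbb K\to\mathbb K$ in degrees $-n,\,1-n$ with differential $(-1)^n$, both with zero multiplication; let $p\colon\Omega[n]\to\mathbb K[n]$ be the projection. The tangent spaces of $F$ are $$T^{i}F=\operatorname{coker}\bigl(F(\Omega[i-1])\xrightarrow{\;p\;}F(\mathbb K[i-1])\bigr),\qquad i\in\mathbb Z.$$ For a differential graded Lie algebra $L=\bigoplus_i L^i$ over $\mathbb K$ and $A\in\mathbf{NA}$, let $L\otimes A$ be the differential graded Lie algebra with $(L\otimes A)^n=\bigoplus_i L^i\otimes A_{n-i}$, $d(x\otimes a)=dx\otimes a+(-1)^{\bar x}x\otimes da$ and $[x\otimes a,y\otimes b]=(-1)^{\bar a\,\bar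 y}[x,y]\otimes ab$. Let $MC_L(A)=\{x\in(L\otimes A)^1\mid dx+\frac12[x,x]=0\}$, and let $\operatorname{Def}_L(A)$ be the quotient of $MC_L(A)$ by the gauge action of the group $\exp((L\otimes A)^0)$, $$e^a w=w+\sum_{n\ge0}\frac{\operatorname{ad}(a)^n}{(n+1)!}\bigl([a,w]-da\bigr).$$ **Theorem.** For every differential graded Lie algebra $L$ over $\mathbb K$, the functor $\operatorname{Def}_L\colon\mathbf{NA}\to\mathbf{Set}$ is a deformation functor. For every $i\in\mathbb Z$ there is a $\mathbb K$-linear isomorphism $$T^i\operatorname{Def}_L\;\cong\;H^i(L)$$ which maps the class of $x\otimes 1[i-1]$ to the class of $x$, for every cocycle $x\in Z^i(L)$. -/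

import Mathlib

open CategoryTheory TensorProduct

universe u v w

/-- A complex of `K`-vector spaces: a vector space `V = ⨁ V_i` graded by `ℤ`, with a linear
map `d` of degree `1` such that `d ∘ d = 0`. -/
structure DGSpace (K : Type u) [Field K] : Type (max u (v + 1)) where
  carrier : Type v
  [addCommGroup : AddCommGroup carrier]
  [module : Module K carrier]
  /-- the homogeneous components `V_i` -/
  gr : ℤ → Submodule K carrier
  internal : DirectSum.IsInternal gr
  d : carrier →ₗ[K] carrier
  d_mem : ∀ {i : ℤ} {x : carrier}, x ∈ gr i → d x ∈ gr (i + 1)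
  d_d : ∀ x : carrier, d (d x) = 0

attribute [instance] DGSpace.addCommGroup DGSpace.module

/-- A differential graded Lie algebra over `K`. -/
structure DGLA (K : Type u) [Field K] : Type (max u (v + 1)) extends DGSpace.{u, v} K where
  bracket : carrier →ₗ[K] carrier →ₗ[K] carrier
  bracket_mem : ∀ {i j : ℤ} {x y : carrier}, x ∈ gr i → y ∈ gr j → bracket x y ∈ gr (i + j)
  skew : ∀ {i j : ℤ} {x y : carrier}, x ∈ gr i → y ∈ gr j →
    bracket x y + (-1 : K) ^ (i * j) • bracket y x = 0
  jacobi : ∀ {i j k : ℤ} {x y z : carrier}, x ∈ gr i → y ∈ gr j → z ∈ gr k →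
    bracket x (bracket y z) = bracket (bracket x y) z + (-1 : K) ^ (i * j) • bracket y (bracket x z)
  leibniz : ∀ {i j : ℤ} {x y : carrier}, x ∈ gr i → y ∈ gr j →
    d (bracket x y) = bracket (d x) y + (-1 : K) ^ i • bracket x (d y)

/-- `mulPow m n` is the power `A ^ (n + 1) = A A ⋯ A` (`n + 1` factors) of the algebra `A` with
multiplication `m`. -/
def mulPow {K : Type u} [Field K] {A : Type v} [AddCommGroup A] [Module K A]
    (m : A →ₗ[K] A →ₗ[K] A) : ℕ → Submodule K A
  | 0 => ⊤
  | n + 1 => Submodule.map₂ m ⊤ (mulPow m n)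

/-- The objects of the category `NA`: finite dimensional, nilpotent, associative, graded
commutative, differential `ℤ`-graded `K`-algebras (without unit). -/
structure NilpDGA (K : Type u) [Field K] : Type (max u (v + 1)) extends DGSpace.{u, v} K where
  mul : carrier →ₗ[K] carrier →ₗ[K] carrier
  mul_mem : ∀ {i j : ℤ} {a b : carrier}, a ∈ gr i → b ∈ gr j → mul a b ∈ gr (i + j)
  mul_assoc : ∀ a b c : carrier, mul (mul a b) c = mul a (mul b c)
  mul_comm : ∀ {i j : ℤ} {a b : carrier}, a ∈ gr i → b ∈ gr j →
    mul a b = (-1 : K) ^ (i * j) • mul b a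
  leibniz : ∀ {i j : ℤ} {a b : carrier}, a ∈ gr i → b ∈ gr j →
    d (mul a b) = mul (d a) b + (-1 : K) ^ i • mul a (d b)
  finite : FiniteDimensional K carrier
  nilpotent : ∃ n : ℕ, mulPow mul n = ⊥

namespace DGSpace

variable {K : Type u} [Field K]

/-- A criterion for a family of subspaces to be a grading: they span, and there are projections. -/
theorem isInternal_of_proj {V : Type v} [AddCommGroup V] [Module K V] {gr : ℤ → Submodule K V}
    (π : ℤ → V →ₗ[K] V) (h1 : ∀ i x, x ∈ gr i → π i x = x)
    (h2 : ∀ i j x, x ∈ gr j → j ≠ i → π i x = 0) (h3 : ∀ x, x ∈ ⨆ i, gr i) :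
    DirectSum.IsInternal gr := by
  rw [DirectSum.isInternal_submodule_iff_iSupIndep_and_iSup_eq_top]
  refine ⟨fun i => ?_, eq_top_iff.2 fun x _ => h3 x⟩
  rw [Submodule.disjoint_def]
  intro x hx hx'
  have : (⨆ j, ⨆ (_ : j ≠ i), gr j) ≤ LinearMap.ker (π i) :=
    iSup_le fun j => iSup_le fun hj y hy => h2 i j y hy hj
  rw [← h1 i x hx]
  exact this hx'

variable (V : DGSpace.{u, v} K)

/-- The linear map which is given by `f i` on the component of degree `i`. -/
noncomputable def gradedMap {W : Type w} [AddCommGroup W] [Module K W]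
    (f : ℤ → V.carrier →ₗ[K] W) : V.carrier →ₗ[K] W :=
  DirectSum.toModule K ℤ W (fun i => f i ∘ₗ (V.gr i).subtype) ∘ₗ
    (LinearEquiv.ofBijective (DirectSum.coeLinearMap V.gr) V.internal).symm.toLinearMap

theorem gradedMap_of_mem {W : Type w} [AddCommGroup W] [Module K W]
    (f : ℤ → V.carrier →ₗ[K] W) {i : ℤ} {x : V.carrier} (hx : x ∈ V.gr i) :
    V.gradedMap f x = f i x := by
  have : (LinearEquiv.ofBijective (DirectSum.coeLinearMap V.gr) V.internal).symm x
      = DirectSum.lof K ℤ (fun i => V.gr i) i ⟨x, hx⟩ := by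
    rw [LinearEquiv.symm_apply_eq]
    exact (DirectSum.coeLinearMap_lof V.gr i ⟨x, hx⟩).symm
  simp [gradedMap, this]

theorem mem_iSup (x : V.carrier) : x ∈ ⨆ i, V.gr i := by
  rw [V.internal.submodule_iSup_eq_top]; trivial

/-- To prove a linear statement for all elements, it suffices to do so for homogeneous ones. -/
theorem induction_gr {p : V.carrier → Prop} (x : V.carrier) (h0 : p 0)
    (hadd : ∀ x y, p x → p y → p (x + y)) (hgr : ∀ i x, x ∈ V.gr i → p x) : p x :=
  Submodule.iSup_induction V.gr (motive := p) (V.mem_iSup x) hgr h0 hadd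

/-- The projection onto the component of degree `i`. -/
noncomputable def proj (i : ℤ) : V.carrier →ₗ[K] V.carrier :=
  V.gradedMap fun j => if j = i then LinearMap.id else 0

/-- The projection onto the sum of the components of even degree. -/
noncomputable def evenPart : V.carrier →ₗ[K] V.carrier :=
  V.gradedMap fun j => if Even j then LinearMap.id else 0

/-- The projection onto the sum of the components of odd degree. -/
noncomputable def oddPart : V.carrier →ₗ[K] V.carrier :=
  V.gradedMap fun j => if Even j then 0 else LinearMap.id

/-- The linear map `x ↦ (-1) ^ i • x` for `x` of degree `i`. -/
noncomputable def parity : V.carrier →ₗ[K] V.carrier :=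
  V.gradedMap fun j => (-1 : K) ^ j • LinearMap.id

theorem proj_same {i : ℤ} {x : V.carrier} (hx : x ∈ V.gr i) : V.proj i x = x := by
  simp [proj, V.gradedMap_of_mem _ hx]

theorem proj_ne {i j : ℤ} {x : V.carrier} (hx : x ∈ V.gr j) (h : j ≠ i) : V.proj i x = 0 := by
  simp [proj, V.gradedMap_of_mem _ hx, h]

theorem proj_mem (i : ℤ) (x : V.carrier) : V.proj i x ∈ V.gr i := by
  refine V.induction_gr (p := fun x => V.proj i x ∈ V.gr i) x (by simp) ?_ ?_
  · intro x y hx hy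
    rw [map_add]
    exact add_mem hx hy
  · intro j x hx
    by_cases h : j = i
    · subst h
      rwa [V.proj_same hx]
    · rw [V.proj_ne hx h]
      exact zero_mem _

theorem exists_sum_proj (x : V.carrier) :
    ∃ s : Finset ℤ, ∀ t : Finset ℤ, s ⊆ t → ∑ i ∈ t, V.proj i x = x := by
  classical
  refine V.induction_gr (p := fun x => ∃ s : Finset ℤ, ∀ t : Finset ℤ, s ⊆ t →
    ∑ i ∈ t, V.proj i x = x) x ⟨∅, by simp⟩ ?_ ?_
  · rintro x y ⟨s, hs⟩ ⟨s', hs'⟩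
    refine ⟨s ∪ s', fun t ht => ?_⟩
    simp only [map_add, Finset.sum_add_distrib]
    rw [hs t (Finset.union_subset_left ht), hs' t (Finset.union_subset_right ht)]
  · intro i x hx
    refine ⟨{i}, fun t ht => ?_⟩
    rw [Finset.sum_eq_single_of_mem i (Finset.singleton_subset_iff.1 ht)
      fun j _ hj => V.proj_ne hx hj.symm, V.proj_same hx]

theorem evenPart_of_mem {i : ℤ} {x : V.carrier} (hx : x ∈ V.gr i) :
    V.evenPart x = if Even i then x else 0 := by
  rw [evenPart, V.gradedMap_of_mem _ hx]
  split_ifs <;> simp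

theorem oddPart_of_mem {i : ℤ} {x : V.carrier} (hx : x ∈ V.gr i) :
    V.oddPart x = if Even i then 0 else x := by
  rw [oddPart, V.gradedMap_of_mem _ hx]
  split_ifs <;> simp

theorem parity_of_mem {i : ℤ} {x : V.carrier} (hx : x ∈ V.gr i) :
    V.parity x = (-1 : K) ^ i • x := by
  rw [parity, V.gradedMap_of_mem _ hx]
  simp

/-- A complex is acyclic if its cohomology vanishes. -/
def Acyclic : Prop := ∀ x : V.carrier, V.d x = 0 → ∃ y : V.carrier, V.d y = x

/-- `Z^i(V)`, the cocycles of degree `i`. -/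
def cocycles (i : ℤ) : Submodule K V.carrier := V.gr i ⊓ LinearMap.ker V.d

/-- `B^i(V)`, the coboundaries of degree `i`. -/
def coboundaries (i : ℤ) : Submodule K V.carrier := (V.gr (i - 1)).map V.d

/-- `H^i(V) = Z^i(V) / B^i(V)`. -/
abbrev Cohomology (i : ℤ) : Type v :=
  ↥(V.cocycles i) ⧸ (V.coboundaries i).submoduleOf (V.cocycles i)

end DGSpace

/-- Signs depend only on the parity of the exponent. -/
theorem sign_eq (K : Type u) [Field K] {m n : ℤ} (t : ℤ) (h : m = n + 2 * t) :
    (-1 : K) ^ m = (-1 : K) ^ n := by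
  rw [h, zpow_add₀ (by simp), zpow_mul]
  simp

namespace DGLA

variable {K : Type u} [Field K] (L : DGLA.{u, v} K) (A : NilpDGA.{u, w} K)

/-- The component of degree `n` of `L ⊗ A`, spanned by the `x ⊗ a` with `x ∈ L^i`, `a ∈ A_j`,
`i + j = n`. -/
def tensorGr (n : ℤ) : Submodule K (L.carrier ⊗[K] A.carrier) :=
  Submodule.span K {t | ∃ (i j : ℤ) (x : L.carrier) (a : A.carrier),
    i + j = n ∧ x ∈ L.gr i ∧ a ∈ A.gr j ∧ t = x ⊗ₜ[K] a}

variable {L A} in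
theorem tmul_mem_tensorGr {i j n : ℤ} {x : L.carrier} {a : A.carrier} (hx : x ∈ L.gr i)
    (ha : a ∈ A.gr j) (h : i + j = n) : x ⊗ₜ[K] a ∈ tensorGr L A n :=
  Submodule.subset_span ⟨i, j, x, a, h, hx, ha, rfl⟩

variable {L A} in
theorem tensorGr_induction {n : ℤ} {p : L.carrier ⊗[K] A.carrier → Prop}
    (h : ∀ (i j : ℤ) (x : L.carrier) (a : A.carrier), i + j = n → x ∈ L.gr i → a ∈ A.gr j →
      p (x ⊗ₜ[K] a))
    (h0 : p 0) (hadd : ∀ s t, p s → p t → p (s + t)) (hsmul : ∀ (c : K) t, p t → p (c • t))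
    {t : L.carrier ⊗[K] A.carrier} (ht : t ∈ tensorGr L A n) : p t := by
  induction ht using Submodule.span_induction with
  | mem t ht =>
    obtain ⟨i, j, x, a, hij, hx, ha, rfl⟩ := ht
    exact h i j x a hij hx ha
  | zero => exact h0
  | add s t _ _ hs ht => exact hadd s t hs ht
  | smul c t _ ht => exact hsmul c t ht

/-- The projection of `L ⊗ A` onto its component of degree `n`. -/
noncomputable def tensorProj (n : ℤ) :
    L.carrier ⊗[K] A.carrier →ₗ[K] L.carrier ⊗[K] A.carrier :=
  TensorProduct.lift (L.toDGSpace.gradedMap fun i =>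
    (TensorProduct.mk K L.carrier A.carrier).compl₂ (A.toDGSpace.proj (n - i)))

theorem tensorProj_tmul (n : ℤ) {i : ℤ} {x : L.carrier} (hx : x ∈ L.gr i) (a : A.carrier) :
    tensorProj L A n (x ⊗ₜ[K] a) = x ⊗ₜ[K] A.toDGSpace.proj (n - i) a := by
  simp [tensorProj, L.toDGSpace.gradedMap_of_mem _ hx]

theorem tensorGr_internal : DirectSum.IsInternal (tensorGr L A) := by
  refine DGSpace.isInternal_of_proj (tensorProj L A) ?_ ?_ ?_
  · intro n t ht
    refine tensorGr_induction (p := fun t => tensorProj L A n t = t) ?_ (by simp) ?_ ?_ ht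
    · intro i j x a hij hx ha
      rw [tensorProj_tmul L A n hx, show n - i = j by omega, A.toDGSpace.proj_same ha]
    · intro s t hs ht
      rw [map_add, hs, ht]
    · intro c t ht
      rw [map_smul, ht]
  · intro n m t ht hmn
    refine tensorGr_induction (p := fun t => tensorProj L A n t = 0) ?_ (by simp) ?_ ?_ ht
    · intro i j x a hij hx ha
      rw [tensorProj_tmul L A n hx, A.toDGSpace.proj_ne ha (by omega), TensorProduct.tmul_zero]
    · intro s t hs ht
      rw [map_add, hs, ht, add_zero]
    · intro c t ht
      rw [map_smul, ht, smul_zero]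
  · intro t
    induction t using TensorProduct.induction_on with
    | zero => exact zero_mem _
    | add s t hs ht => exact add_mem hs ht
    | tmul x a =>
      refine L.toDGSpace.induction_gr (p := fun x => x ⊗ₜ[K] a ∈ ⨆ n, tensorGr L A n) x
        (by simp) (fun x y hx hy => by rw [TensorProduct.add_tmul]; exact add_mem hx hy) ?_
      intro i x hx
      refine A.toDGSpace.induction_gr (p := fun a => x ⊗ₜ[K] a ∈ ⨆ n, tensorGr L A n) a
        (by simp) (fun a b ha hb => by rw [TensorProduct.tmul_add]; exact add_mem ha hb) ?_
      intro j a ha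
      exact Submodule.mem_iSup_of_mem (i + j) (tmul_mem_tensorGr hx ha rfl)

/-- The differential of `L ⊗ A`: `d (x ⊗ a) = d x ⊗ a + (-1) ^ i • x ⊗ d a` for `x ∈ L^i`. -/
noncomputable def tensorD : L.carrier ⊗[K] A.carrier →ₗ[K] L.carrier ⊗[K] A.carrier :=
  TensorProduct.map L.d LinearMap.id + TensorProduct.map L.toDGSpace.parity A.d

theorem tensorD_tmul {i : ℤ} {x : L.carrier} (hx : x ∈ L.gr i) (a : A.carrier) :
    tensorD L A (x ⊗ₜ[K] a) = L.d x ⊗ₜ[K] a + (-1 : K) ^ i • x ⊗ₜ[K] A.d a := by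
  simp [tensorD, L.toDGSpace.parity_of_mem hx, TensorProduct.smul_tmul']

/-- The bracket of `L ⊗ A`: `[x ⊗ a, y ⊗ b] = (-1) ^ (i * j) • [x, y] ⊗ a b` for `a ∈ A_i`
and `y ∈ L^j` (see `tensorBracket_tmul`); the sign is `1` if `j` is even, and `(-1) ^ i` if `j`
is odd. -/
noncomputable def tensorBracket : L.carrier ⊗[K] A.carrier →ₗ[K]
    L.carrier ⊗[K] A.carrier →ₗ[K] L.carrier ⊗[K] A.carrier :=
  (TensorProduct.map₂ L.bracket A.mul).compl₂
      (TensorProduct.map L.toDGSpace.evenPart LinearMap.id) +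
    (TensorProduct.map₂ L.bracket (A.mul ∘ₗ A.toDGSpace.parity)).compl₂
      (TensorProduct.map L.toDGSpace.oddPart LinearMap.id)

theorem tensorBracket_tmul_any (x y : L.carrier) (a b : A.carrier) :
    tensorBracket L A (x ⊗ₜ[K] a) (y ⊗ₜ[K] b) =
      L.bracket x (L.toDGSpace.evenPart y) ⊗ₜ[K] A.mul a b +
      L.bracket x (L.toDGSpace.oddPart y) ⊗ₜ[K] A.mul (A.toDGSpace.parity a) b := by
  simp [tensorBracket, TensorProduct.map₂_apply_tmul]

theorem tensorBracket_tmul {i j : ℤ} {a : A.carrier} {y : L.carrier} (ha : a ∈ A.gr i)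
    (hy : y ∈ L.gr j) (x : L.carrier) (b : A.carrier) :
    tensorBracket L A (x ⊗ₜ[K] a) (y ⊗ₜ[K] b) =
      (-1 : K) ^ (i * j) • L.bracket x y ⊗ₜ[K] A.mul a b := by
  rw [tensorBracket_tmul_any, L.toDGSpace.evenPart_of_mem hy, L.toDGSpace.oddPart_of_mem hy,
    A.toDGSpace.parity_of_mem ha]
  by_cases hj : Even j
  · simp [hj, Even.neg_one_zpow (hj.mul_left i)]
  · have : (-1 : K) ^ (i * j) = (-1 : K) ^ i := by
      rw [mul_comm, zpow_mul, (Int.not_even_iff_odd.1 hj).neg_one_zpow]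
    simp [hj, this]

/-- The differential graded Lie algebra `L ⊗ A`. -/
noncomputable abbrev tensor : DGLA.{u, max v w} K where
  carrier := L.carrier ⊗[K] A.carrier
  gr := tensorGr L A
  internal := tensorGr_internal L A
  d := tensorD L A
  d_mem := by
    intro n t ht
    refine tensorGr_induction (p := fun t => tensorD L A t ∈ tensorGr L A (n + 1)) ?_ (by simp)
      (fun s t hs ht => by rw [map_add]; exact add_mem hs ht)
      (fun c t ht => by rw [map_smul]; exact Submodule.smul_mem _ c ht) ht
    intro i j x a hij hx ha
    rw [tensorD_tmul L A hx]
    exact add_mem (tmul_mem_tensorGr (L.d_mem hx) ha (by omega))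
      (Submodule.smul_mem _ _ (tmul_mem_tensorGr hx (A.d_mem ha) (by omega)))
  d_d := by
    intro t
    have : t ∈ ⨆ n, tensorGr L A n := by
      rw [(tensorGr_internal L A).submodule_iSup_eq_top]; trivial
    refine Submodule.iSup_induction _ (motive := fun t => tensorD L A (tensorD L A t) = 0) this
      ?_ (by simp) (fun s t hs ht => by rw [map_add, map_add, hs, ht, add_zero])
    intro n t ht
    refine tensorGr_induction (p := fun t => tensorD L A (tensorD L A t) = 0) ?_ (by simp)
      (fun s t hs ht => by rw [map_add, map_add, hs, ht, add_zero])
      (fun c t ht => by rw [map_smul, map_smul, ht, smul_zero]) ht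
    intro i j x a hij hx ha
    rw [tensorD_tmul L A hx, map_add, map_smul, tensorD_tmul L A (L.d_mem hx),
      tensorD_tmul L A hx, L.d_d, A.d_d, zpow_add₀ (by simp)]
    simp
  bracket := tensorBracket L A
  bracket_mem := by
    intro m n s t hs ht
    refine tensorGr_induction (p := fun s => tensorBracket L A s t ∈ tensorGr L A (m + n)) ?_
      (by simp)
      (fun s t hs ht => by rw [map_add, LinearMap.add_apply]; exact add_mem hs ht)
      (fun c t ht => by
        rw [map_smul, LinearMap.smul_apply]; exact Submodule.smul_mem _ c ht) hs
    intro i j x a hij hx ha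
    refine tensorGr_induction
      (p := fun t => tensorBracket L A (x ⊗ₜ[K] a) t ∈ tensorGr L A (m + n)) ?_ (by simp)
      (fun s t hs ht => by rw [map_add]; exact add_mem hs ht)
      (fun c t ht => by rw [map_smul]; exact Submodule.smul_mem _ c ht) ht
    intro k l y b hkl hy hb
    rw [tensorBracket_tmul L A ha hy]
    exact Submodule.smul_mem _ _
      (tmul_mem_tensorGr (L.bracket_mem hx hy) (A.mul_mem ha hb) (by omega))
  skew := by
    intro m n s t hs ht
    refine tensorGr_induction (p := fun s => tensorBracket L A s t +
      (-1 : K) ^ (m * n) • tensorBracket L A t s = 0) ?_ (by simp) ?_ ?_ hs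
    rotate_left
    · intro s s' h h'
      simp only [map_add, LinearMap.add_apply, smul_add]
      rw [add_add_add_comm, h, h', add_zero]
    · intro c s h
      simp only [map_smul, LinearMap.smul_apply]
      rw [smul_comm, ← smul_add, h, smul_zero]
    intro i j x a hij hx ha
    refine tensorGr_induction (p := fun t => tensorBracket L A (x ⊗ₜ[K] a) t +
      (-1 : K) ^ (m * n) • tensorBracket L A t (x ⊗ₜ[K] a) = 0) ?_ (by simp) ?_ ?_ ht
    rotate_left
    · intro s s' h h'
      simp only [map_add, LinearMap.add_apply, smul_add]
      rw [add_add_add_comm, h, h', add_zero]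
    · intro c s h
      simp only [map_smul, LinearMap.smul_apply]
      rw [smul_comm, ← smul_add, h, smul_zero]
    intro k l y b hkl hy hb
    rw [tensorBracket_tmul L A ha hy, tensorBracket_tmul L A hb hx,
      eq_neg_of_add_eq_zero_left (L.skew hx hy), A.mul_comm ha hb]
    subst hij hkl
    simp only [TensorProduct.neg_tmul, TensorProduct.smul_tmul', TensorProduct.tmul_smul,
      smul_neg, smul_smul]
    rw [neg_add_eq_zero]
    congr 2
    rw [← zpow_add₀ (by simp), ← zpow_add₀ (by simp), ← zpow_add₀ (by simp)]
    refine sign_eq K (-(i * l)) ?_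
    ring
  jacobi := by
    intro m n r s t u hs ht hu
    refine tensorGr_induction (p := fun s => tensorBracket L A s (tensorBracket L A t u) =
      tensorBracket L A (tensorBracket L A s t) u +
      (-1 : K) ^ (m * n) • tensorBracket L A t (tensorBracket L A s u)) ?_ (by simp) ?_ ?_ hs
    rotate_left
    · intro s s' h h'
      simp only [map_add, LinearMap.add_apply, smul_add, h, h']
      abel
    · intro c s h
      simp only [map_smul, LinearMap.smul_apply, h, smul_add]
      rw [smul_comm]
    intro i j x a hij hx ha
    refine tensorGr_induction (p := fun t => tensorBracket L A (x ⊗ₜ[K] a)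
      (tensorBracket L A t u) = tensorBracket L A (tensorBracket L A (x ⊗ₜ[K] a) t) u +
      (-1 : K) ^ (m * n) • tensorBracket L A t (tensorBracket L A (x ⊗ₜ[K] a) u))
      ?_ (by simp) ?_ ?_ ht
    rotate_left
    · intro s s' h h'
      simp only [map_add, LinearMap.add_apply, smul_add, h, h']
      abel
    · intro c s h
      simp only [map_smul, LinearMap.smul_apply, h, smul_add]
      rw [smul_comm]
    intro k l y b hkl hy hb
    refine tensorGr_induction (p := fun u => tensorBracket L A (x ⊗ₜ[K] a)
      (tensorBracket L A (y ⊗ₜ[K] b) u) =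
      tensorBracket L A (tensorBracket L A (x ⊗ₜ[K] a) (y ⊗ₜ[K] b)) u +
      (-1 : K) ^ (m * n) • tensorBracket L A (y ⊗ₜ[K] b) (tensorBracket L A (x ⊗ₜ[K] a) u))
      ?_ (by simp) ?_ ?_ hu
    rotate_left
    · intro s s' h h'
      simp only [map_add, smul_add, h, h']
      abel
    · intro c s h
      simp only [map_smul, h, smul_add]
      rw [smul_comm]
    intro p q z c hpq hz hc
    subst hij hkl
    rw [tensorBracket_tmul L A hb hz, tensorBracket_tmul L A ha hz, tensorBracket_tmul L A ha hy,
      map_smul, map_smul, map_smul, LinearMap.smul_apply,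
      tensorBracket_tmul L A ha (L.bracket_mem hy hz),
      tensorBracket_tmul L A hb (L.bracket_mem hx hz),
      tensorBracket_tmul L A (A.mul_mem ha hb) hz,
      L.jacobi hx hy hz, ← A.mul_assoc a b c, ← A.mul_assoc b a c, A.mul_comm hb ha]
    simp only [TensorProduct.add_tmul, TensorProduct.smul_tmul', TensorProduct.tmul_smul,
      smul_add, smul_smul, map_smul, LinearMap.smul_apply]
    simp only [← zpow_add₀ (show (-1 : K) ≠ 0 by simp)]
    congr 3
    · refine sign_eq K 0 ?_
      ring
    · refine sign_eq K (-(i * l + j * l)) ?_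
      ring
  leibniz := by
    intro m n s t hs ht
    refine tensorGr_induction (p := fun s => tensorD L A (tensorBracket L A s t) =
      tensorBracket L A (tensorD L A s) t + (-1 : K) ^ m • tensorBracket L A s (tensorD L A t))
      ?_ (by simp) ?_ ?_ hs
    rotate_left
    · intro s s' h h'
      simp only [map_add, LinearMap.add_apply, smul_add, h, h']
      abel
    · intro c s h
      simp only [map_smul, LinearMap.smul_apply, h, smul_add]
      rw [smul_comm]
    intro i j x a hij hx ha
    refine tensorGr_induction (p := fun t => tensorD L A (tensorBracket L A (x ⊗ₜ[K] a) t) =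
      tensorBracket L A (tensorD L A (x ⊗ₜ[K] a)) t +
      (-1 : K) ^ m • tensorBracket L A (x ⊗ₜ[K] a) (tensorD L A t)) ?_ (by simp) ?_ ?_ ht
    rotate_left
    · intro s s' h h'
      simp only [map_add, smul_add, h, h']
      abel
    · intro c s h
      simp only [map_smul, h, smul_add]
      rw [smul_comm]
    intro k l y b hkl hy hb
    subst hij
    rw [tensorBracket_tmul L A ha hy, tensorD_tmul L A hx, tensorD_tmul L A hy, map_smul,
      tensorD_tmul L A (L.bracket_mem hx hy), map_add, map_add, map_smul, map_smul,
      LinearMap.add_apply, LinearMap.smul_apply, tensorBracket_tmul L A ha hy,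
      tensorBracket_tmul L A (A.d_mem ha) hy, tensorBracket_tmul L A ha (L.d_mem hy),
      tensorBracket_tmul L A ha hy, L.leibniz hx hy, A.leibniz ha hb]
    simp only [TensorProduct.add_tmul, TensorProduct.tmul_add, TensorProduct.smul_tmul',
      TensorProduct.tmul_smul, smul_add, smul_smul]
    simp only [← zpow_add₀ (show (-1 : K) ≠ 0 by simp)]
    rw [sign_eq K (m := j * k + (i + k)) (n := i + (j + 1) * k) 0 (by ring),
      sign_eq K (m := i + j + j * (k + 1)) (n := j * k + i) j (by ring),
      sign_eq K (m := j * k + (i + k + j)) (n := i + j + (k + j * k)) 0 (by ring)]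
    abel

end DGLA

namespace NilpDGA

variable {K : Type u} [Field K]

/-- Morphisms of `NA`: morphisms of graded algebras commuting with the differentials. -/
@[ext]
structure Hom (A B : NilpDGA.{u, v} K) : Type v where
  toLin : A.carrier →ₗ[K] B.carrier
  map_gr : ∀ {i : ℤ} {a : A.carrier}, a ∈ A.gr i → toLin a ∈ B.gr i
  map_d : ∀ a : A.carrier, toLin (A.d a) = B.d (toLin a)
  map_mul : ∀ a b : A.carrier, toLin (A.mul a b) = B.mul (toLin a) (toLin b)

instance : Category.{v} (NilpDGA.{u, v} K) where
  Hom A B := Hom A B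
  id A := ⟨LinearMap.id, fun h => h, fun _ => rfl, fun _ _ => rfl⟩
  comp f g := ⟨g.toLin ∘ₗ f.toLin, fun h => g.map_gr (f.map_gr h),
    fun a => by simp [f.map_d, g.map_d], fun a b => by simp [f.map_mul, g.map_mul]⟩

theorem hom_ext {A B : NilpDGA.{u, v} K} {f g : A ⟶ B} (h : ∀ a, f.toLin a = g.toLin a) : f = g :=
  Hom.ext (LinearMap.ext h)

theorem comp_toLin {A B C : NilpDGA.{u, v} K} (f : A ⟶ B) (g : B ⟶ C) (a : A.carrier) :
    (f ≫ g).toLin a = g.toLin (f.toLin a) := rfl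

theorem id_toLin {A : NilpDGA.{u, v} K} (a : A.carrier) : (𝟙 A : A ⟶ A).toLin a = a := rfl

theorem map_parity {A B : NilpDGA.{u, v} K} (f : A ⟶ B) (a : A.carrier) :
    f.toLin (A.toDGSpace.parity a) = B.toDGSpace.parity (f.toLin a) := by
  refine A.toDGSpace.induction_gr
    (p := fun a => f.toLin (A.toDGSpace.parity a) = B.toDGSpace.parity (f.toLin a)) a
    (by simp) (fun a b ha hb => by simp only [map_add, ha, hb]) ?_
  intro i a ha
  rw [A.toDGSpace.parity_of_mem ha, B.toDGSpace.parity_of_mem (f.map_gr ha), map_smul]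

end NilpDGA

namespace DGLA

variable {K : Type u} [Field K]

/-- The set `MC(N)` of solutions of the Maurer-Cartan equation of `N`. -/
def MC (N : DGLA.{u, v} K) : Set N.carrier :=
  {x | x ∈ N.gr 1 ∧ N.d x + (1 / 2 : K) • N.bracket x x = 0}

/-- The gauge action `e^a w = w + ∑_n ad(a)^n / (n + 1)! ([a, w] - d a)` of `a ∈ N^0` on `N^1`.
The sum is finite if `ad(a)` is nilpotent, as for all `N = L ⊗ A` (see `ad_tensor_nilpotent`). -/
noncomputable def gauge (N : DGLA.{u, v} K) (a w : N.carrier) : N.carrier :=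
  w + ∑ᶠ n : ℕ, ((Nat.factorial (n + 1) : ℕ) : K)⁻¹ •
    ((N.bracket a : Module.End K N.carrier) ^ n) (N.bracket a w - N.d a)

/-- Two Maurer-Cartan elements are gauge equivalent if they are in the same orbit of the gauge
action of `exp(N^0)`, whose elements are the `e^a` with `a ∈ N^0`. -/
def GaugeEquiv (N : DGLA.{u, v} K) (x y : N.MC) : Prop :=
  ∃ a ∈ N.gr 0, (y : N.carrier) = N.gauge a x

variable (L : DGLA.{u, v} K)

/-- The image in `L ⊗ A` of `L ⊗ A ^ (n + 1)`. -/
noncomputable def tensorPow (A : NilpDGA.{u, w} K) (n : ℕ) : Submodule K (L.tensor A).carrier :=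
  Submodule.span K {t | ∃ (x : L.carrier) (a : A.carrier), a ∈ mulPow A.mul n ∧ t = x ⊗ₜ[K] a}

theorem bracket_mem_tensorPow (A : NilpDGA.{u, w} K) (n : ℕ) (s t : (L.tensor A).carrier)
    (ht : t ∈ tensorPow L A n) : (L.tensor A).bracket s t ∈ tensorPow L A (n + 1) := by
  induction ht using Submodule.span_induction with
  | zero => simp
  | add t t' _ _ h h' => rw [map_add]; exact add_mem h h'
  | smul c t _ h => rw [map_smul]; exact Submodule.smul_mem _ c h
  | mem t ht =>
    obtain ⟨y, b, hb, rfl⟩ := ht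
    change tensorBracket L A s (y ⊗ₜ[K] b) ∈ _
    change L.carrier ⊗[K] A.carrier at s
    induction s using TensorProduct.induction_on with
    | zero => rw [map_zero]; exact zero_mem _
    | add s s' h h' => rw [map_add]; exact add_mem h h'
    | tmul x a =>
      rw [tensorBracket_tmul_any]
      exact add_mem
        (Submodule.subset_span ⟨_, _, Submodule.apply_mem_map₂ _ Submodule.mem_top hb, rfl⟩)
        (Submodule.subset_span ⟨_, _, Submodule.apply_mem_map₂ _ Submodule.mem_top hb, rfl⟩)

theorem ad_tensor_nilpotent (A : NilpDGA.{u, w} K) :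
    ∃ N : ℕ, ∀ n, N ≤ n → ∀ s t : (L.tensor A).carrier,
      (((L.tensor A).bracket s : Module.End K (L.tensor A).carrier) ^ n) t = 0 := by
  obtain ⟨N, hN⟩ := A.nilpotent
  refine ⟨N, fun n hn s t => ?_⟩
  have key : ∀ n, (((L.tensor A).bracket s : Module.End K (L.tensor A).carrier) ^ n) t ∈
      tensorPow L A n := by
    intro n
    induction n with
    | zero =>
      change L.carrier ⊗[K] A.carrier at t
      rw [pow_zero]
      change t ∈ _
      induction t using TensorProduct.induction_on with
      | zero => exact zero_mem _
      | add s s' h h' => exact add_mem h h'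
      | tmul x a => exact Submodule.subset_span ⟨x, a, Submodule.mem_top, rfl⟩
    | succ n ih =>
      rw [pow_succ']
      exact bracket_mem_tensorPow L A n s _ ih
  have hbot : tensorPow L A N = ⊥ := by
    rw [tensorPow, Submodule.span_eq_bot]
    rintro t ⟨x, a, ha, rfl⟩
    rw [hN, Submodule.mem_bot] at ha
    rw [ha, TensorProduct.tmul_zero]
  have h0 : (((L.tensor A).bracket s : Module.End K (L.tensor A).carrier) ^ N) t = 0 := by
    have := key N
    rwa [hbot, Submodule.mem_bot] at this
  obtain ⟨m, rfl⟩ := Nat.exists_eq_add_of_le' hn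
  rw [pow_add, Module.End.mul_apply, h0, map_zero]

section functoriality

variable {A B : NilpDGA.{u, w} K} (f : A ⟶ B)

/-- The map `L ⊗ A → L ⊗ B` induced by a morphism `A → B`. -/
noncomputable def tensorMap : (L.tensor A).carrier →ₗ[K] (L.tensor B).carrier :=
  TensorProduct.map LinearMap.id f.toLin

theorem tensorMap_gr {n : ℤ} {t : (L.tensor A).carrier} (ht : t ∈ (L.tensor A).gr n) :
    L.tensorMap f t ∈ (L.tensor B).gr n := by
  refine tensorGr_induction (p := fun t => L.tensorMap f t ∈ (L.tensor B).gr n) ?_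
    (by rw [map_zero]; exact zero_mem _)
    (fun s t hs ht => by rw [map_add]; exact add_mem hs ht)
    (fun c t ht => by rw [map_smul]; exact Submodule.smul_mem _ c ht) ht
  intro i j x a hij hx ha
  exact tmul_mem_tensorGr hx (f.map_gr ha) hij

theorem tensorMap_d (t : (L.tensor A).carrier) :
    L.tensorMap f ((L.tensor A).d t) = (L.tensor B).d (L.tensorMap f t) := by
  change TensorProduct.map LinearMap.id f.toLin (tensorD L A t) =
    tensorD L B (TensorProduct.map LinearMap.id f.toLin t)
  change L.carrier ⊗[K] A.carrier at t
  induction t using TensorProduct.induction_on with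
  | zero => simp
  | add s t hs ht => simp only [map_add, hs, ht]
  | tmul x a => simp [tensorD, f.map_d]

theorem tensorMap_bracket (s t : (L.tensor A).carrier) :
    L.tensorMap f ((L.tensor A).bracket s t) =
      (L.tensor B).bracket (L.tensorMap f s) (L.tensorMap f t) := by
  change TensorProduct.map LinearMap.id f.toLin (tensorBracket L A s t) =
    tensorBracket L B (TensorProduct.map LinearMap.id f.toLin s)
      (TensorProduct.map LinearMap.id f.toLin t)
  change L.carrier ⊗[K] A.carrier at s t
  induction s using TensorProduct.induction_on with
  | zero => simp
  | add s s' hs hs' => simp only [map_add, LinearMap.add_apply, hs, hs']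
  | tmul x a =>
    induction t using TensorProduct.induction_on with
    | zero => simp
    | add t t' ht ht' => simp only [map_add, ht, ht']
    | tmul y b =>
      simp only [tensorBracket_tmul_any, TensorProduct.map_tmul, map_add, LinearMap.id_apply,
        f.map_mul, NilpDGA.map_parity]

theorem tensorMap_gauge (a x : (L.tensor A).carrier) :
    L.tensorMap f ((L.tensor A).gauge a x) =
      (L.tensor B).gauge (L.tensorMap f a) (L.tensorMap f x) := by
  have hpow : ∀ (n : ℕ) (t : (L.tensor A).carrier),
      L.tensorMap f ((((L.tensor A).bracket a : Module.End K (L.tensor A).carrier) ^ n) t) =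
      (((L.tensor B).bracket (L.tensorMap f a) : Module.End K (L.tensor B).carrier) ^ n)
        (L.tensorMap f t) := by
    intro n t
    induction n with
    | zero => rfl
    | succ n ih =>
      rw [pow_succ', pow_succ', Module.End.mul_apply, Module.End.mul_apply, tensorMap_bracket, ih]
  obtain ⟨N, hN⟩ := ad_tensor_nilpotent L A
  have hfin : Function.HasFiniteSupport (fun n : ℕ => ((Nat.factorial (n + 1) : ℕ) : K)⁻¹ •
      (((L.tensor A).bracket a : Module.End K (L.tensor A).carrier) ^ n)
        ((L.tensor A).bracket a x - (L.tensor A).d a)) := by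
    refine (Set.finite_lt_nat N).subset fun n hn => ?_
    by_contra h
    exact hn (by
      change ((Nat.factorial (n + 1) : ℕ) : K)⁻¹ • _ = _
      rw [hN n (not_lt.1 h), smul_zero])
  have h1 := (L.tensorMap f).toAddMonoidHom.map_finsum hfin
  rw [gauge, gauge, map_add]
  congr 1
  refine h1.trans (finsum_congr fun n => ?_)
  change L.tensorMap f _ = _
  rw [map_smul, hpow, map_sub, tensorMap_bracket, tensorMap_d]

/-- The map `MC(L ⊗ A) → MC(L ⊗ B)` induced by a morphism `A → B`. -/
noncomputable def mcMap (x : (L.tensor A).MC) : (L.tensor B).MC :=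
  ⟨L.tensorMap f x, L.tensorMap_gr f x.2.1, by
    rw [← tensorMap_d, ← tensorMap_bracket, ← map_smul, ← map_add, x.2.2, map_zero]⟩

end functoriality

/-- The functor `Def_L : NA → Set`: it sends `A` to the quotient of `MC(L ⊗ A)` by the gauge
action of `exp((L ⊗ A)^0)`. -/
noncomputable def Def : NilpDGA.{u, w} K ⥤ Type (max v w) where
  obj A := Quot (L.tensor A).GaugeEquiv
  map {A B} f := TypeCat.ofHom (Quot.map (L.mcMap f) (by
    rintro x y ⟨a, ha, h⟩
    refine ⟨L.tensorMap f a, L.tensorMap_gr f ha, ?_⟩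
    change L.tensorMap f y = _
    rw [h, tensorMap_gauge]
    rfl))
  map_id A := by
    ext x
    induction x using Quot.ind with
    | mk x =>
      refine congrArg (Quot.mk _) (Subtype.ext ?_)
      exact LinearMap.congr_fun (TensorProduct.map_id (R := K)) x.1
  map_comp {A B C} f g := by
    ext x
    induction x using Quot.ind with
    | mk x =>
      refine congrArg (Quot.mk _) (Subtype.ext ?_)
      exact LinearMap.congr_fun
        (TensorProduct.map_comp (LinearMap.id (R := K) (M := L.carrier)) g.toLin
          LinearMap.id f.toLin) x.1

end DGLA

section mulPow

variable {K : Type u} [Field K] {A : Type v} [AddCommGroup A] [Module K A]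

theorem mulPow_eq_bot_of_le {m : A →ₗ[K] A →ₗ[K] A} {n n' : ℕ} (h : n ≤ n')
    (hn : mulPow m n = ⊥) : mulPow m n' = ⊥ := by
  induction n', h using Nat.le_induction with
  | base => exact hn
  | succ k _ ih => rw [mulPow, ih, Submodule.map₂_bot_right]

theorem mulPow_map {B : Type w} [AddCommGroup B] [Module K B] {m : A →ₗ[K] A →ₗ[K] A}
    {m' : B →ₗ[K] B →ₗ[K] B} (f : A →ₗ[K] B) (hf : ∀ a b, f (m a b) = m' (f a) (f b)) (n : ℕ) :
    mulPow m n ≤ (mulPow m' n).comap f := by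
  induction n with
  | zero => exact fun _ _ => Submodule.mem_top
  | succ n ih =>
    refine Submodule.map₂_le.2 fun a _ b hb => ?_
    rw [Submodule.mem_comap, hf]
    exact Submodule.apply_mem_map₂ _ Submodule.mem_top (ih hb)

end mulPow

namespace NilpDGA

variable {K : Type u} [Field K]

/-- The zero algebra. -/
noncomputable def zero (K : Type u) [Field K] : NilpDGA.{u, v} K where
  carrier := PUnit
  gr _ := ⊤
  internal := DGSpace.isInternal_of_proj (fun _ => LinearMap.id) (fun _ _ _ => rfl)
    (fun _ _ _ _ _ => rfl) (fun _ => Submodule.mem_iSup_of_mem 0 Submodule.mem_top)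
  d := 0
  d_mem := fun _ => Submodule.mem_top
  d_d := fun _ => rfl
  mul := 0
  mul_mem := fun _ _ => Submodule.mem_top
  mul_assoc := fun _ _ _ => rfl
  mul_comm := fun _ _ => rfl
  leibniz := fun _ _ => rfl
  finite := inferInstance
  nilpotent := ⟨0, Subsingleton.elim _ _⟩

theorem map_proj {A B : NilpDGA.{u, v} K} (f : A ⟶ B) (i : ℤ) (a : A.carrier) :
    f.toLin (A.toDGSpace.proj i a) = B.toDGSpace.proj i (f.toLin a) := by
  refine A.toDGSpace.induction_gr
    (p := fun a => f.toLin (A.toDGSpace.proj i a) = B.toDGSpace.proj i (f.toLin a)) a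
    (by simp) (fun a b ha hb => by simp only [map_add, ha, hb]) ?_
  intro j a ha
  by_cases hj : j = i
  · subst hj
    rw [A.toDGSpace.proj_same ha, B.toDGSpace.proj_same (f.map_gr ha)]
  · rw [A.toDGSpace.proj_ne ha hj, B.toDGSpace.proj_ne (f.map_gr ha) hj, map_zero]

/-- The subspace `{(a, b) | α a = β b}` of `A × B`. -/
noncomputable abbrev fiberSubmodule {A B C : NilpDGA.{u, v} K} (α : A ⟶ C) (β : B ⟶ C) :
    Submodule K (A.carrier × B.carrier) :=
  LinearMap.eqLocus (α.toLin ∘ₗ LinearMap.fst K A.carrier B.carrier)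
    (β.toLin ∘ₗ LinearMap.snd K A.carrier B.carrier)

/-- The componentwise product on `{(a, b) | α a = β b}`. -/
noncomputable def fiberMul {A B C : NilpDGA.{u, v} K} (α : A ⟶ C) (β : B ⟶ C) :
    fiberSubmodule α β →ₗ[K] fiberSubmodule α β →ₗ[K] fiberSubmodule α β :=
  LinearMap.mk₂ K
    (fun x y => ⟨(A.mul x.1.1 y.1.1, B.mul x.1.2 y.1.2), by
      have hx : α.toLin x.1.1 = β.toLin x.1.2 := x.2
      have hy : α.toLin y.1.1 = β.toLin y.1.2 := y.2
      change α.toLin (A.mul _ _) = β.toLin (B.mul _ _)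
      rw [α.map_mul, β.map_mul, hx, hy]⟩)
    (fun x y z => by ext <;> simp) (fun c x y => by ext <;> simp)
    (fun x y z => by ext <;> simp) (fun c x y => by ext <;> simp)

/-- The fibre product `A ×_C B = {(a, b) | α a = β b}` with the componentwise structure. -/
noncomputable def fiberProd {A B C : NilpDGA.{u, v} K} (α : A ⟶ C) (β : B ⟶ C) :
    NilpDGA.{u, v} K where
  carrier := fiberSubmodule α β
  gr i := ((A.gr i).prod (B.gr i)).submoduleOf _
  internal := by
    refine DGSpace.isInternal_of_proj
      (fun i => ((A.toDGSpace.proj i).prodMap (B.toDGSpace.proj i)).restrict (by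
        rintro ⟨a, b⟩ h
        change α.toLin a = β.toLin b at h
        change α.toLin (A.toDGSpace.proj i a) = β.toLin (B.toDGSpace.proj i b)
        rw [map_proj, map_proj, h])) ?_ ?_ ?_
    · exact fun i x hx => Subtype.ext
        (Prod.ext (A.toDGSpace.proj_same hx.1) (B.toDGSpace.proj_same hx.2))
    · exact fun i j x hx hij => Subtype.ext
        (Prod.ext (A.toDGSpace.proj_ne hx.1 hij) (B.toDGSpace.proj_ne hx.2 hij))
    · rintro ⟨⟨a, b⟩, h⟩
      classical
      have h' : α.toLin a = β.toLin b := h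
      obtain ⟨s, hs⟩ := A.toDGSpace.exists_sum_proj a
      obtain ⟨t, ht⟩ := B.toDGSpace.exists_sum_proj b
      let y : ℤ → fiberSubmodule α β := fun i =>
        ⟨(A.toDGSpace.proj i a, B.toDGSpace.proj i b), by
          change α.toLin (A.toDGSpace.proj i a) = β.toLin (B.toDGSpace.proj i b)
          rw [map_proj, map_proj, h']⟩
      have hy : (⟨(a, b), h⟩ : fiberSubmodule α β) = ∑ i ∈ s ∪ t, y i := by
        refine Subtype.ext ?_
        rw [AddSubmonoidClass.coe_finsetSum]
        refine Prod.ext ?_ ?_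
        · rw [Prod.fst_sum]
          exact (hs _ Finset.subset_union_left).symm
        · rw [Prod.snd_sum]
          exact (ht _ Finset.subset_union_right).symm
      rw [hy]
      exact sum_mem fun i _ => Submodule.mem_iSup_of_mem i
        ⟨A.toDGSpace.proj_mem i a, B.toDGSpace.proj_mem i b⟩
  d := (A.d.prodMap B.d).restrict (by
    rintro ⟨a, b⟩ h
    change α.toLin a = β.toLin b at h
    change α.toLin (A.d a) = β.toLin (B.d b)
    rw [α.map_d, β.map_d, h])
  d_mem := fun h => ⟨A.d_mem h.1, B.d_mem h.2⟩
  d_d := fun x => Subtype.ext (Prod.ext (A.d_d _) (B.d_d _))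
  mul := fiberMul α β
  mul_mem := fun h h' => ⟨A.mul_mem h.1 h'.1, B.mul_mem h.2 h'.2⟩
  mul_assoc := fun x y z => Subtype.ext (Prod.ext (A.mul_assoc _ _ _) (B.mul_assoc _ _ _))
  mul_comm := fun h h' => Subtype.ext (Prod.ext (A.mul_comm h.1 h'.1) (B.mul_comm h.2 h'.2))
  leibniz := fun h h' => Subtype.ext (Prod.ext (A.leibniz h.1 h'.1) (B.leibniz h.2 h'.2))
  finite := by
    have := A.finite
    have := B.finite
    exact FiniteDimensional.finiteDimensional_submodule _
  nilpotent := by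
    obtain ⟨n, hn⟩ := A.nilpotent
    obtain ⟨n', hn'⟩ := B.nilpotent
    refine ⟨max n n', (Submodule.eq_bot_iff _).2 fun x hx => ?_⟩
    have h1 := mulPow_map (m' := A.mul) (LinearMap.fst K A.carrier B.carrier ∘ₗ
      (fiberSubmodule α β).subtype) (fun _ _ => rfl) _ hx
    have h2 := mulPow_map (m' := B.mul) (LinearMap.snd K A.carrier B.carrier ∘ₗ
      (fiberSubmodule α β).subtype) (fun _ _ => rfl) _ hx
    rw [mulPow_eq_bot_of_le (le_max_left _ _) hn] at h1
    rw [mulPow_eq_bot_of_le (le_max_right _ _) hn'] at h2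
    exact Subtype.ext (Prod.ext h1 h2)

end NilpDGA

namespace NilpDGA

variable {K : Type u} [Field K]

/-- The projection `A ×_C B → A`. -/
noncomputable def fiberFst {A B C : NilpDGA.{u, v} K} (α : A ⟶ C) (β : B ⟶ C) :
    fiberProd α β ⟶ A :=
  ⟨LinearMap.fst K A.carrier B.carrier ∘ₗ (fiberSubmodule α β).subtype, fun h => h.1,
    fun _ => rfl, fun _ _ => rfl⟩

/-- The projection `A ×_C B → B`. -/
noncomputable def fiberSnd {A B C : NilpDGA.{u, v} K} (α : A ⟶ C) (β : B ⟶ C) :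
    fiberProd α β ⟶ B :=
  ⟨LinearMap.snd K A.carrier B.carrier ∘ₗ (fiberSubmodule α β).subtype, fun h => h.2,
    fun _ => rfl, fun _ _ => rfl⟩

theorem fiber_condition {A B C : NilpDGA.{u, v} K} (α : A ⟶ C) (β : B ⟶ C) :
    fiberFst α β ≫ α = fiberSnd α β ≫ β :=
  hom_ext fun x => x.2

/-- `A` has trivial multiplication, that is, `A ∈ NA ∩ DG`. -/
def TrivialMul (A : NilpDGA.{u, v} K) : Prop := ∀ a b : A.carrier, A.mul a b = 0

/-- `0 → ker α → A → B → 0` is a small extension: `α` is surjective and `A · ker α = 0`. -/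
structure IsSmallExtension {A B : NilpDGA.{u, v} K} (α : A ⟶ B) : Prop where
  surjective : Function.Surjective α.toLin
  annihilates : ∀ a x : A.carrier, α.toLin x = 0 → A.mul a x = 0

/-- A small extension whose kernel is an acyclic complex. -/
structure IsAcyclicSmallExtension {A B : NilpDGA.{u, v} K} (α : A ⟶ B) : Prop
    extends IsSmallExtension α where
  acyclic : ∀ x : A.carrier, α.toLin x = 0 → A.d x = 0 →
    ∃ y : A.carrier, α.toLin y = 0 ∧ A.d y = x

/-- The zero morphism `A → B`. -/
noncomputable def zeroHom (A B : NilpDGA.{u, v} K) : A ⟶ B :=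
  ⟨0, fun _ => zero_mem _, fun _ => (map_zero B.d).symm, fun _ _ => by simp⟩

theorem eq_zeroHom {A : NilpDGA.{u, v} K} (f : A ⟶ zero K) : f = zeroHom A (zero K) :=
  hom_ext fun _ => rfl

/-- The sum of two morphisms to an algebra with trivial multiplication. -/
noncomputable def addHom {A B : NilpDGA.{u, v} K} (hB : B.TrivialMul) (f g : A ⟶ B) : A ⟶ B :=
  ⟨f.toLin + g.toLin, fun h => add_mem (f.map_gr h) (g.map_gr h),
    fun a => by simp [f.map_d, g.map_d], fun a b => by
      rw [LinearMap.add_apply, f.map_mul, g.map_mul, hB, hB, hB, add_zero]⟩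

/-- A scalar multiple of a morphism to an algebra with trivial multiplication. -/
noncomputable def smulHom {A B : NilpDGA.{u, v} K} (hB : B.TrivialMul) (c : K) (f : A ⟶ B) :
    A ⟶ B :=
  ⟨c • f.toLin, fun h => Submodule.smul_mem _ c (f.map_gr h),
    fun a => by simp [f.map_d], fun a b => by
      rw [LinearMap.smul_apply, f.map_mul, hB, hB, smul_zero]⟩

/-- The product `A × B`, as fibre product over the zero algebra. -/
noncomputable abbrev prod (A B : NilpDGA.{u, v} K) : NilpDGA.{u, v} K :=
  fiberProd (zeroHom A (zero K)) (zeroHom B (zero K))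

noncomputable abbrev prodFst (A B : NilpDGA.{u, v} K) : prod A B ⟶ A := fiberFst _ _

noncomputable abbrev prodSnd (A B : NilpDGA.{u, v} K) : prod A B ⟶ B := fiberSnd _ _

/-- The morphism `(f, g)` to the product. -/
noncomputable def prodLift {A B C : NilpDGA.{u, v} K} (f : C ⟶ A) (g : C ⟶ B) : C ⟶ prod A B :=
  ⟨(f.toLin.prod g.toLin).codRestrict (fiberSubmodule _ _) (fun _ => rfl),
    fun h => ⟨f.map_gr h, g.map_gr h⟩,
    fun a => Subtype.ext (Prod.ext (f.map_d a) (g.map_d a)),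
    fun a b => Subtype.ext (Prod.ext (f.map_mul a b) (g.map_mul a b))⟩

theorem zero_trivialMul : (zero.{u, v} K).TrivialMul := fun _ _ => rfl

theorem zero_acyclic : (zero.{u, v} K).toDGSpace.Acyclic := fun _ _ => ⟨0, rfl⟩

/-- The component of degree `i` of the graded vector space which is `K` in degree `m`. -/
def lineGr (K : Type u) [Field K] (m i : ℤ) : Submodule K K := if i = m then ⊤ else ⊥

theorem mem_lineGr (m : ℤ) (x : K) : x ∈ lineGr K m m := by simp [lineGr]

theorem eq_zero_of_mem_lineGr {m i : ℤ} {x : K} (h : i ≠ m) (hx : x ∈ lineGr K m i) : x = 0 := by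
  simpa [lineGr, h] using hx

/-- The projections of the graded vector space which is `K` in degree `m`. -/
def lineProj (K : Type u) [Field K] (m i : ℤ) : K →ₗ[K] K := if i = m then LinearMap.id else 0

theorem lineProj_same {m i : ℤ} {x : K} (hx : x ∈ lineGr K m i) : lineProj K m i x = x := by
  by_cases h : i = m
  · simp [lineProj, h]
  · rw [eq_zero_of_mem_lineGr h hx, map_zero]

theorem lineProj_ne {m i j : ℤ} {x : K} (hx : x ∈ lineGr K m j) (h : j ≠ i) :
    lineProj K m i x = 0 := by
  by_cases hi : i = m
  · rw [eq_zero_of_mem_lineGr (fun hj => h (hj.trans hi.symm)) hx, map_zero]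
  · simp [lineProj, hi]

/-- The complex `K[n]`: the field `K` in degree `-n`, with trivial multiplication. -/
noncomputable def shiftK (K : Type u) [Field K] (n : ℤ) : NilpDGA.{u, u} K where
  carrier := K
  gr i := lineGr K (-n) i
  internal := DGSpace.isInternal_of_proj (lineProj K (-n)) (fun _ _ hx => lineProj_same hx)
    (fun _ _ _ hx h => lineProj_ne hx h)
    (fun x => Submodule.mem_iSup_of_mem (-n) (mem_lineGr (-n) x))
  d := 0
  d_mem := fun _ => zero_mem _
  d_d := fun _ => rfl
  mul := 0
  mul_mem := fun _ _ => zero_mem _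
  mul_assoc := fun _ _ _ => rfl
  mul_comm := fun _ _ => (smul_zero _).symm
  leibniz := fun _ _ => by simp
  finite := inferInstance
  nilpotent := ⟨1, eq_bot_iff.2 (Submodule.map₂_le.2 fun _ _ _ _ => zero_mem _)⟩

/-- The complex `Ω[n]`: spanned by `(1, 0)` in degree `-n` and `(0, 1)` in degree `1 - n`, with
`d (1, 0) = (-1) ^ n (0, 1)` and with trivial multiplication. -/
noncomputable def omega (K : Type u) [Field K] (n : ℤ) : NilpDGA.{u, u} K where
  carrier := K × K
  gr i := (lineGr K (-n) i).prod (lineGr K (1 - n) i)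
  internal := DGSpace.isInternal_of_proj
    (fun i => (lineProj K (-n) i).prodMap (lineProj K (1 - n) i))
    (fun _ _ hx => Prod.ext (lineProj_same hx.1) (lineProj_same hx.2))
    (fun _ _ _ hx h => Prod.ext (lineProj_ne hx.1 h) (lineProj_ne hx.2 h))
    (fun x => by
      rw [show x = (x.1, 0) + (0, x.2) by simp]
      exact add_mem
        (Submodule.mem_iSup_of_mem (-n) ⟨mem_lineGr (-n) x.1, zero_mem (lineGr K (1 - n) (-n))⟩)
        (Submodule.mem_iSup_of_mem (1 - n)
          ⟨zero_mem (lineGr K (-n) (1 - n)), mem_lineGr (1 - n) x.2⟩))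
  d := (-1 : K) ^ n • (LinearMap.inr K K K ∘ₗ LinearMap.fst K K K)
  d_mem := by
    rintro i ⟨x, y⟩ ⟨hx, -⟩
    refine Submodule.smul_mem _ _ ⟨zero_mem (lineGr K (-n) (i + 1)), ?_⟩
    change x ∈ lineGr K (1 - n) (i + 1)
    by_cases h : i = -n
    · rw [show i + 1 = 1 - n by omega]
      exact mem_lineGr _ _
    · rw [show x = 0 from eq_zero_of_mem_lineGr h hx]
      exact zero_mem _
  d_d := fun x => by simp
  mul := 0
  mul_mem := fun _ _ => zero_mem _
  mul_assoc := fun _ _ _ => rfl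
  mul_comm := fun _ _ => (smul_zero _).symm
  leibniz := fun _ _ => by simp
  finite := inferInstance
  nilpotent := ⟨1, eq_bot_iff.2 (Submodule.map₂_le.2 fun _ _ _ _ => zero_mem _)⟩

/-- The generator `1[n]` of `K[n]`. -/
def shiftOne (K : Type u) [Field K] (n : ℤ) : (shiftK K n).carrier := (1 : K)

theorem shiftOne_mem (n : ℤ) : shiftOne K n ∈ (shiftK K n).gr (-n) := mem_lineGr (-n) (1 : K)

theorem shiftK_trivialMul (n : ℤ) : (shiftK K n).TrivialMul := fun _ _ => rfl

theorem omega_trivialMul (n : ℤ) : (omega K n).TrivialMul := fun _ _ => rfl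

/-- The projection `p : Ω[n] → K[n]`. -/
noncomputable def omegaProj (K : Type u) [Field K] (n : ℤ) : omega K n ⟶ shiftK K n :=
  ⟨LinearMap.fst K K K, fun h => h.1, fun x => by
    change ((-1 : K) ^ n • ((0 : K), x.1)).1 = 0
    simp, fun _ _ => rfl⟩

end NilpDGA

section functors

open NilpDGA

variable {K : Type u} [Field K]

/-- The map `η : F(A ×_C B) → F(A) ×_{F(C)} F(B)`. -/
noncomputable def fiberComparison (F : NilpDGA.{u, v} K ⥤ Type w) {A B C : NilpDGA.{u, v} K}
    (α : A ⟶ C) (β : B ⟶ C) (z : F.obj (fiberProd α β)) :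
    {p : F.obj A × F.obj B // F.map α p.1 = F.map β p.2} :=
  ⟨(F.map (fiberFst α β) z, F.map (fiberSnd α β) z), by
    rw [← Functor.map_comp_apply, fiber_condition, Functor.map_comp_apply]⟩

/-- Predeformation functors `NA → Set`: `F(0)` is a point; `η` is surjective if `α` is surjective,
and bijective if moreover `C` is an acyclic complex with trivial multiplication; and
`F(A) → F(B)` is surjective for every acyclic small extension `A → B`. -/
structure IsPredeformationFunctor (F : NilpDGA.{u, v} K ⥤ Type w) : Prop where
  map_zero : Nonempty (Unique (F.obj (NilpDGA.zero K)))
  surjective : ∀ {A B C : NilpDGA.{u, v} K} (α : A ⟶ C) (β : B ⟶ C),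
    Function.Surjective α.toLin → Function.Surjective (fiberComparison F α β)
  bijective : ∀ {A B C : NilpDGA.{u, v} K} (α : A ⟶ C) (β : B ⟶ C),
    Function.Surjective α.toLin → C.TrivialMul → C.toDGSpace.Acyclic →
      Function.Bijective (fiberComparison F α β)
  lift : ∀ {A B : NilpDGA.{u, v} K} (α : A ⟶ B), IsAcyclicSmallExtension α →
    Function.Surjective (F.map α)

/-- Deformation functors `NA → Set`: predeformation functors such that `F(I)` is a point for every
acyclic complex `I` with trivial multiplication. -/
structure IsDeformationFunctor (F : NilpDGA.{u, v} K ⥤ Type w) : Prop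
    extends IsPredeformationFunctor F where
  acyclic : ∀ I : NilpDGA.{u, v} K, I.TrivialMul → I.toDGSpace.Acyclic →
    Nonempty (Unique (F.obj I))

namespace IsPredeformationFunctor

variable {F : NilpDGA.{u, v} K ⥤ Type w}

theorem existsUnique_prod (hF : IsPredeformationFunctor F) {A B : NilpDGA.{u, v} K}
    (x : F.obj A) (y : F.obj B) :
    ∃! z : F.obj (prod A B), F.map (prodFst A B) z = x ∧ F.map (prodSnd A B) z = y := by
  obtain ⟨h0⟩ := hF.map_zero
  have hbij := hF.bijective (zeroHom A (NilpDGA.zero K)) (zeroHom B (NilpDGA.zero K))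
    (fun _ => ⟨0, rfl⟩) zero_trivialMul zero_acyclic
  obtain ⟨z, hz⟩ := hbij.2 ⟨(x, y), Subsingleton.elim _ _⟩
  have hz' := Prod.ext_iff.1 (Subtype.ext_iff.1 hz)
  refine ⟨z, hz', fun z' h' => hbij.1 (Subtype.ext (Prod.ext ?_ ?_))⟩
  · exact h'.1.trans hz'.1.symm
  · exact h'.2.trans hz'.2.symm

/-- For `A ∈ NA ∩ DG`, the set `F(A)`, on which there is a natural structure of vector space. -/
def Vec (_ : IsPredeformationFunctor F) (A : NilpDGA.{u, v} K) (_ : A.TrivialMul) : Type w :=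
  F.obj A

section Vec

variable (hF : IsPredeformationFunctor F) {A B C : NilpDGA.{u, v} K} (hA : A.TrivialMul)
  (hB : B.TrivialMul)

/-- The map `F(f) : F(C) → F(A)` for a morphism `f : C → A`. -/
noncomputable def ev (f : C ⟶ A) (x : F.obj C) : hF.Vec A hA := F.map f x

/-- The sum is induced by the addition `A × A → A` under `F(A × A) = F(A) × F(A)`. -/
noncomputable instance : Add (hF.Vec A hA) :=
  ⟨fun x y => hF.ev hA (addHom hA (prodFst A A) (prodSnd A A)) (hF.existsUnique_prod x y).choose⟩

/-- The scalar multiplication is induced by the scalar multiplications `A → A`. -/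
noncomputable instance : SMul K (hF.Vec A hA) := ⟨fun c x => hF.ev hA (smulHom hA c (𝟙 A)) x⟩

/-- The zero element is the image of `F(0) → F(A)`. -/
noncomputable instance : Zero (hF.Vec A hA) :=
  ⟨hF.ev hA (zeroHom (NilpDGA.zero K) A) hF.map_zero.some.default⟩

noncomputable instance : Neg (hF.Vec A hA) := ⟨fun x => (-1 : K) • x⟩

theorem ev_comp {D : NilpDGA.{u, v} K} (g : D ⟶ C) (f : C ⟶ A) (x : F.obj D) :
    hF.ev hA (g ≫ f) x = hF.ev hA f (F.map g x) :=
  Functor.map_comp_apply F g f x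

theorem ev_ev (g : C ⟶ A) (f : A ⟶ B) (x : F.obj C) :
    hF.ev hB f (hF.ev hA g x) = hF.ev hB (g ≫ f) x :=
  (hF.ev_comp hB g f x).symm

theorem ev_id (x : F.obj A) : hF.ev hA (𝟙 A) x = x :=
  Functor.map_id_apply F A x

theorem ev_zero (x : F.obj C) : hF.ev hA (zeroHom C A) x = 0 := by
  obtain ⟨h0⟩ := hF.map_zero
  have : zeroHom C A = zeroHom C (NilpDGA.zero K) ≫ zeroHom (NilpDGA.zero K) A :=
    hom_ext fun _ => rfl
  rw [this, ev_comp]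
  exact congrArg _ (Subsingleton.elim _ _)

theorem ev_add (f g : C ⟶ A) (x : F.obj C) :
    hF.ev hA f x + hF.ev hA g x = hF.ev hA (addHom hA f g) x := by
  have h := (hF.existsUnique_prod (F.map f x) (F.map g x)).choose_spec
  have h1 := h.2 (F.map (prodLift f g) x)
    ⟨by rw [← Functor.map_comp_apply]; rfl, by rw [← Functor.map_comp_apply]; rfl⟩
  have : addHom hA f g = prodLift f g ≫ addHom hA (prodFst A A) (prodSnd A A) :=
    hom_ext fun _ => rfl
  rw [this, ev_comp, h1]
  rfl

theorem ev_smul (c : K) (f : C ⟶ A) (x : F.obj C) :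
    c • hF.ev hA f x = hF.ev hA (smulHom hA c f) x := by
  have : smulHom hA c f = f ≫ smulHom hA c (𝟙 A) := hom_ext fun _ => rfl
  rw [this, ev_comp]
  rfl

/-- Two elements of `F(A)` are the images of a single element. -/
theorem exists_ev₂ (x y : hF.Vec A hA) : ∃ (C : NilpDGA.{u, v} K) (f g : C ⟶ A) (z : F.obj C),
    x = hF.ev hA f z ∧ y = hF.ev hA g z := by
  obtain ⟨z, hz, -⟩ := hF.existsUnique_prod (A := A) (B := A) x y
  exact ⟨_, _, _, z, hz.1.symm, hz.2.symm⟩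

/-- Three elements of `F(A)` are the images of a single element. -/
theorem exists_ev₃ (x y z : hF.Vec A hA) : ∃ (C : NilpDGA.{u, v} K) (f g h : C ⟶ A)
    (t : F.obj C), x = hF.ev hA f t ∧ y = hF.ev hA g t ∧ z = hF.ev hA h t := by
  obtain ⟨C, f, g, s, rfl, rfl⟩ := hF.exists_ev₂ hA x y
  obtain ⟨t, ⟨rfl, ht⟩, -⟩ := hF.existsUnique_prod (A := C) (B := A) s z
  exact ⟨_, prodFst C A ≫ f, prodFst C A ≫ g, prodSnd C A, t, (hF.ev_comp hA _ _ _).symm,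
    (hF.ev_comp hA _ _ _).symm, ht.symm⟩

noncomputable instance : AddCommGroup (hF.Vec A hA) where
  add_assoc x y z := by
    obtain ⟨C, f, g, h, t, rfl, rfl, rfl⟩ := hF.exists_ev₃ hA x y z
    simp only [ev_add]
    exact congrArg (fun k => hF.ev hA k t) (hom_ext fun a =>
      add_assoc (f.toLin a) (g.toLin a) (h.toLin a))
  zero_add x := by
    obtain ⟨C, f, -, t, rfl, -⟩ := hF.exists_ev₂ hA x x
    rw [← hF.ev_zero hA t, ev_add]
    exact congrArg (fun k => hF.ev hA k t) (hom_ext fun a => zero_add (f.toLin a))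
  add_zero x := by
    obtain ⟨C, f, -, t, rfl, -⟩ := hF.exists_ev₂ hA x x
    rw [← hF.ev_zero hA t, ev_add]
    exact congrArg (fun k => hF.ev hA k t) (hom_ext fun a => add_zero (f.toLin a))
  add_comm x y := by
    obtain ⟨C, f, g, t, rfl, rfl⟩ := hF.exists_ev₂ hA x y
    simp only [ev_add]
    exact congrArg (fun k => hF.ev hA k t) (hom_ext fun a =>
      add_comm (f.toLin a) (g.toLin a))
  neg_add_cancel x := by
    obtain ⟨C, f, -, t, rfl, -⟩ := hF.exists_ev₂ hA x x
    change (-1 : K) • hF.ev hA f t + hF.ev hA f t = 0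
    rw [ev_smul, ev_add, ← hF.ev_zero hA t]
    refine congrArg (fun k => hF.ev hA k t) (hom_ext fun a => ?_)
    change (-1 : K) • f.toLin a + f.toLin a = 0
    simp
  nsmul := nsmulRec
  zsmul := zsmulRec

noncomputable instance : Module K (hF.Vec A hA) where
  one_smul x := by
    obtain ⟨C, f, -, t, rfl, -⟩ := hF.exists_ev₂ hA x x
    rw [ev_smul]
    exact congrArg (fun k => hF.ev hA k t) (hom_ext fun a => one_smul K (f.toLin a))
  mul_smul c c' x := by
    obtain ⟨C, f, -, t, rfl, -⟩ := hF.exists_ev₂ hA x x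
    simp only [ev_smul]
    exact congrArg (fun k => hF.ev hA k t) (hom_ext fun a => mul_smul c c' (f.toLin a))
  smul_zero c := by
    rw [← hF.ev_zero hA hF.map_zero.some.default, ev_smul]
    exact congrArg (fun k => hF.ev hA k _) (hom_ext fun a => smul_zero c)
  smul_add c x y := by
    obtain ⟨C, f, g, t, rfl, rfl⟩ := hF.exists_ev₂ hA x y
    simp only [ev_smul, ev_add]
    exact congrArg (fun k => hF.ev hA k t) (hom_ext fun a =>
      smul_add c (f.toLin a) (g.toLin a))
  add_smul c c' x := by
    obtain ⟨C, f, -, t, rfl, -⟩ := hF.exists_ev₂ hA x x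
    simp only [ev_smul, ev_add]
    exact congrArg (fun k => hF.ev hA k t) (hom_ext fun a => add_smul c c' (f.toLin a))
  zero_smul x := by
    obtain ⟨C, f, -, t, rfl, -⟩ := hF.exists_ev₂ hA x x
    rw [ev_smul, ← hF.ev_zero hA t]
    exact congrArg (fun k => hF.ev hA k t) (hom_ext fun a => zero_smul K (f.toLin a))

/-- The linear map `F(f) : F(A) → F(B)` for a morphism `f : A → B` in `NA ∩ DG`. -/
noncomputable def vecMap (f : A ⟶ B) : hF.Vec A hA →ₗ[K] hF.Vec B hB where
  toFun x := hF.ev hB f x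
  map_add' x y := by
    obtain ⟨C, g, h, t, rfl, rfl⟩ := hF.exists_ev₂ hA x y
    simp only [ev_ev, ev_add]
    exact congrArg (fun k => hF.ev hB k t) (hom_ext fun a =>
      map_add f.toLin (g.toLin a) (h.toLin a))
  map_smul' c x := by
    obtain ⟨C, g, -, t, rfl, -⟩ := hF.exists_ev₂ hA x x
    simp only [ev_ev, ev_smul, RingHom.id_apply]
    exact congrArg (fun k => hF.ev hB k t) (hom_ext fun a => map_smul f.toLin c (g.toLin a))

end Vec

/-- The tangent space `T^i F`, the cokernel of `F(Ω[n]) → F(K[n])` for `n = i - 1`. -/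
abbrev Tangent {F : NilpDGA.{u, u} K ⥤ Type w} (hF : IsPredeformationFunctor F) (i : ℤ) :
    Type w :=
  hF.Vec (shiftK K (i - 1)) (shiftK_trivialMul (i - 1)) ⧸
    LinearMap.range (hF.vecMap (omega_trivialMul (i - 1)) (shiftK_trivialMul (i - 1))
      (omegaProj K (i - 1)))

/-- The class in `T^i F` of an element of `F(K[n])`, `n = i - 1`. -/
noncomputable def tangentClass {F : NilpDGA.{u, u} K ⥤ Type w} (hF : IsPredeformationFunctor F) (i : ℤ)
    (x : F.obj (shiftK K (i - 1))) : hF.Tangent i :=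
  Submodule.Quotient.mk (id x : hF.Vec (shiftK K (i - 1)) (shiftK_trivialMul (i - 1)))

end IsPredeformationFunctor

end functors

/-- The Maurer-Cartan element `x ⊗ 1[i - 1]` of `L ⊗ K[i - 1]`, for a cocycle `x ∈ Z^i(L)`. -/
noncomputable def DGLA.cocycleMC {K : Type u} [Field K] (L : DGLA.{u, v} K) {i : ℤ}
    (x : L.toDGSpace.cocycles i) : (L.tensor (NilpDGA.shiftK K (i - 1))).MC :=
  ⟨x.1 ⊗ₜ[K] NilpDGA.shiftOne K (i - 1),
    DGLA.tmul_mem_tensorGr x.2.1 (NilpDGA.shiftOne_mem (i - 1)) (by omega), by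
    have hd : L.d x.1 = 0 := x.2.2
    have h1 : DGLA.tensorD L (NilpDGA.shiftK K (i - 1)) (x.1 ⊗ₜ[K] NilpDGA.shiftOne K (i - 1)) =
        0 := by
      rw [DGLA.tensorD_tmul L _ x.2.1, hd, show (NilpDGA.shiftK K (i - 1)).d = 0 from rfl]
      simp
    have h2 : DGLA.tensorBracket L (NilpDGA.shiftK K (i - 1))
        (x.1 ⊗ₜ[K] NilpDGA.shiftOne K (i - 1)) (x.1 ⊗ₜ[K] NilpDGA.shiftOne K (i - 1)) = 0 := by
      rw [DGLA.tensorBracket_tmul_any, show (NilpDGA.shiftK K (i - 1)).mul = 0 from rfl]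
      simp
    change DGLA.tensorD L _ _ + (1 / 2 : K) • DGLA.tensorBracket L _ _ _ = 0
    rw [h1, h2, smul_zero, add_zero]⟩

/-- The element of `Def_L(K[i - 1])` given by a cocycle `x ∈ Z^i(L)`. -/
noncomputable def DGLA.cocycleDef {K : Type u} [Field K] (L : DGLA.{u, v} K) {i : ℤ}
    (x : L.toDGSpace.cocycles i) : (DGLA.Def.{u, v, u} L).obj (NilpDGA.shiftK K (i - 1)) :=
  Quot.mk _ (L.cocycleMC x)

/-!
The gauge action on `N = L ⊗ A` is an exponential: on `N × K`, where `(w, 1)` stands for the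
operator `w + d`, the element `a ∈ N^0` acts by the nilpotent operator
`affAd a : (w, s) ↦ ([a, w] - s d a, 0)`, and `e^a w` is the first component of
`exp (affAd a) (w, 1)` (`DGLA.flow_apply_one`). Since `affAd a` is a derivation of the curvature
form `(w, 1) ↦ 2 d w + [w, w]`, the gauge action preserves Maurer-Cartan elements
(`DGLA.gauge_mem_MC`), and two of these have the same class in `Def_L(A)` if and only if a finite
product of exponentials maps one to the other (`DGLA.mk_eq_mk_iff`).

*Surjectivity of `η`.* `L ⊗ -` preserves fibre products and surjections, because `L` is flat. So an
equivalence between the images of `x` and `y` in `L ⊗ C` lifts to an equivalence from `x` to some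
`x'` which has the same image as `y`.

*Injectivity of `η` for acyclic `C` with `C · C = 0`.* Let `z` and `z'` have equivalent components.
In the abelian algebra `L ⊗ C`, a product of exponentials acts as `w ↦ w - d (∑ a_i)`, so the sums
of the exponents of the two equivalences differ there by a cocycle, which is a coboundary. It is the
image of an exponent `d e + [x, e]` which fixes the first component `x` of `z`, so the sums may be
taken to be equal. After the second equivalence has been lifted to the fibre product, there remains
a product `∏ e^{a_i}` over `A` with `∑ a_i` in the ideal `𝔥 = (L ⊗ ker α)^0`, which contains all
brackets. By a weak form of the Baker-Campbell-Hausdorff formula, it is a product of exponentials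
of elements of `𝔥` (`NilpExp.exists_prod_exp_eq_of_sum_mem`), and these lift to the fibre product.
The weak form is proved with polynomial paths: `u(t) = ∏ e^{t a_i}` satisfies `u' = y u` with `y`
having coefficients in `𝔥`. If `Y` is a primitive of `y`, then `v = e^{-Y} u` satisfies an equation
of the same kind with coefficients deeper in a filtration of `𝔥`, and the process stops.

*Acyclic small extensions.* `L ⊗ I` is acyclic if `I` is, by a contracting homotopy. The curvature
of a lift of a Maurer-Cartan element is a cocycle of `L ⊗ ker α`, hence a coboundary `d s`, and
subtracting `s` corrects the lift.

*Tangent spaces.* `Def_L(Ω[n])` is a point since `Ω[n]` is acyclic. Therefore `T^i Def_L` is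
`Def_L(K[i - 1])`, which is `Z^i(L)` modulo `B^i(L)` because `L ⊗ K[i - 1]` is abelian and
isomorphic to `L` with a shift of degrees.
-/

/-! ### Exponentials in nilpotent algebras -/

namespace NilpExp

open IsNilpotent Polynomial

section Conj

variable {R : Type*} [Ring R] [Algebra ℚ R]

/-- `e^a b e^{-a} = e^{ad a} b`, where `ad a` is the commutator with `a`. -/
theorem exp_mul_mul_exp_neg {a : R} (ha : IsNilpotent a) (b : R) :
    exp a * b * exp (-a) = exp (LinearMap.mulLeft ℚ a - LinearMap.mulRight ℚ a) b := by
  obtain ⟨k, hk⟩ := id ha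
  have hl : (LinearMap.mulLeft ℚ a) ^ k = 0 := by
    rw [LinearMap.pow_mulLeft, hk]; ext; simp
  have hr : (LinearMap.mulRight ℚ (-a)) ^ k = 0 := by
    rw [LinearMap.pow_mulRight, neg_pow, hk]; ext; simp
  have hk' : (-a) ^ k = 0 := by rw [neg_pow, hk, mul_zero]
  have hsub : LinearMap.mulLeft ℚ a - LinearMap.mulRight ℚ a =
      LinearMap.mulLeft ℚ a + LinearMap.mulRight ℚ (-a) := by
    ext x; simp [sub_eq_add_neg]
  have hc : Commute (LinearMap.mulLeft ℚ a) (LinearMap.mulRight ℚ (-a)) :=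
    LinearMap.commute_mulLeft_right a (-a)
  rw [hsub, exp_add_of_commute hc ⟨k, hl⟩ ⟨k, hr⟩, exp_eq_sum hl, exp_eq_sum hr, exp_eq_sum hk,
    exp_eq_sum hk']
  simp only [LinearMap.pow_mulLeft, LinearMap.pow_mulRight, Module.End.mul_apply,
    LinearMap.sum_apply, LinearMap.smul_apply, LinearMap.mulLeft_apply, LinearMap.mulRight_apply,
    mul_assoc, Finset.sum_mul, Finset.mul_sum, smul_mul_assoc, mul_smul_comm]

/-- Up to a subspace `S` which is stable under `ad a` and contains `[a, [a, b]]`, conjugation with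
`e^a` sends `b` to its first order approximation `b + [a, b]`. -/
theorem exp_conj_sub_mem {a : R} (ha : IsNilpotent a) (b : R) (S : Submodule ℚ R)
    (hS : ∀ s ∈ S, a * s - s * a ∈ S)
    (hab : a * (a * b - b * a) - (a * b - b * a) * a ∈ S) :
    exp a * b * exp (-a) - (b + (a * b - b * a)) ∈ S := by
  have had : IsNilpotent (LinearMap.mulLeft ℚ a - LinearMap.mulRight ℚ a) := by
    refine Commute.isNilpotent_sub (LinearMap.commute_mulLeft_right a a) ?_ ?_
    · obtain ⟨k, hk⟩ := ha
      exact ⟨k, by rw [LinearMap.pow_mulLeft, hk]; ext; simp⟩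
    · obtain ⟨k, hk⟩ := ha
      exact ⟨k, by rw [LinearMap.pow_mulRight, hk]; ext; simp⟩
  rw [exp_mul_mul_exp_neg ha]
  obtain ⟨k, hk⟩ := had
  have hk2 : (LinearMap.mulLeft ℚ a - LinearMap.mulRight ℚ a) ^ (k + 2) = 0 := by
    rw [pow_add, hk, zero_mul]
  rw [exp_eq_sum hk2, Finset.sum_range_succ', Finset.sum_range_succ']
  have hmem : ∀ n : ℕ, ((LinearMap.mulLeft ℚ a - LinearMap.mulRight ℚ a) ^ (n + 2)) b ∈ S := by
    intro n
    induction n with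
    | zero => simpa [pow_two] using hab
    | succ n ih =>
      rw [show n + 1 + 2 = (n + 2) + 1 by ring, pow_succ', Module.End.mul_apply]
      exact hS _ ih
  simp only [LinearMap.add_apply, LinearMap.sum_apply, LinearMap.smul_apply]
  have h1 : (((0 + 1 : ℕ).factorial : ℚ)⁻¹ •
      ((LinearMap.mulLeft ℚ a - LinearMap.mulRight ℚ a) ^ (0 + 1)) b) = a * b - b * a := by simp
  have h0 : (((0 : ℕ).factorial : ℚ)⁻¹ •
      ((LinearMap.mulLeft ℚ a - LinearMap.mulRight ℚ a) ^ 0) b) = b := by simp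
  rw [h1, h0]
  have : ∀ s : R, s + (a * b - b * a) + b - (b + (a * b - b * a)) = s := fun s => by abel
  rw [this]
  exact sum_mem fun n _ => S.smul_mem _ (hmem n)

end Conj

section Poly

variable {R : Type*} [Ring R] [Algebra ℚ R]

/-- The polynomials with coefficients in the subspace `F`. -/
def polySub (F : Submodule ℚ R) : Submodule ℚ R[X] where
  carrier := {p | ∀ n, p.coeff n ∈ F}
  add_mem' hp hq n := by rw [coeff_add]; exact add_mem (hp n) (hq n)
  zero_mem' n := by rw [coeff_zero]; exact zero_mem _
  smul_mem' c p hp n := by rw [coeff_smul]; exact F.smul_mem c (hp n)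

theorem polySub_mono {F F' : Submodule ℚ R} (h : F ≤ F') : polySub F ≤ polySub F' :=
  fun _ hp n => h (hp n)

/-- If left multiplication by the elements of `F` moves along a finite filtration `J` of `R`, then
the polynomials with coefficients in `F` are nilpotent. -/
theorem isNilpotent_of_mem_polySub {F : Submodule ℚ R} {J : ℕ → Submodule ℚ R} (hJ0 : J 0 = ⊤)
    (hJ : ∀ n, ∀ a ∈ F, ∀ b ∈ J n, a * b ∈ J (n + 1)) {M : ℕ} (hM : J M = ⊥) {p : R[X]}
    (hp : p ∈ polySub F) : IsNilpotent p := by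
  have key : ∀ n : ℕ, p ^ n ∈ polySub (J n) := by
    intro n
    induction n with
    | zero => intro k; rw [hJ0]; trivial
    | succ n ih =>
      intro k
      rw [pow_succ', coeff_mul]
      exact sum_mem fun x _ => hJ n _ (hp x.1) _ (ih x.2)
  refine ⟨M, Polynomial.ext fun k => ?_⟩
  have := key M k
  rw [hM, Submodule.mem_bot] at this
  rw [this, coeff_zero]

theorem commutator_mem_polySub {F F' F'' : Submodule ℚ R}
    (h : ∀ a ∈ F, ∀ b ∈ F', a * b - b * a ∈ F'') {p q : R[X]} (hp : p ∈ polySub F)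
    (hq : q ∈ polySub F') : p * q - q * p ∈ polySub F'' := fun n => by
  rw [coeff_sub, coeff_mul, coeff_mul, ← Finset.Nat.sum_antidiagonal_swap (n := n)
    (f := fun x => q.coeff x.1 * p.coeff x.2), ← Finset.sum_sub_distrib]
  exact sum_mem fun x _ => h _ (hp x.1) _ (hq x.2)

/-- The value of a polynomial at the central element `1`, as a ring homomorphism. -/
noncomputable def evalOne (R : Type*) [Ring R] : R[X] →+* R :=
  eval₂RingHom' (RingHom.id R) 1 fun _ => Commute.one_right _

theorem evalOne_C {R : Type*} [Ring R] (r : R) : evalOne R (C r) = r := by simp [evalOne]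

theorem evalOne_X {R : Type*} [Ring R] : evalOne R X = 1 := by simp [evalOne]

theorem evalOne_mem {F : Submodule ℚ R} {p : R[X]} (hp : p ∈ polySub F) : evalOne R p ∈ F := by
  change eval₂ (RingHom.id R) 1 p ∈ F
  rw [eval₂_eq_sum_range]
  exact sum_mem fun n _ => by simpa using hp n

/-- The derivation `d/dt` of `R[t]`. -/
noncomputable def ddt (R : Type*) [Ring R] [Algebra ℚ R] : Module.End ℚ R[X] where
  toFun p := derivative p
  map_add' := by simp
  map_smul' c p := by simp

theorem ddt_apply (p : R[X]) : ddt R p = derivative p := rfl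

/-- The commutator of `d/dt` with the multiplication by `p` is the multiplication by `p'`. -/
theorem ddt_mul_mulLeft (p : R[X]) : ddt R * LinearMap.mulLeft ℚ p -
    LinearMap.mulLeft ℚ p * ddt R = LinearMap.mulLeft ℚ (derivative p) := by
  refine LinearMap.ext fun q => ?_
  simp [ddt_apply, derivative_mul]

theorem exists_derivative_eq {F : Submodule ℚ R} {p : R[X]} (hp : p ∈ polySub F) :
    ∃ q ∈ polySub F, derivative q = p ∧ q.coeff 0 = 0 := by
  refine ⟨∑ n ∈ p.support, monomial (n + 1) (((n : ℚ) + 1)⁻¹ • p.coeff n), ?_, ?_, ?_⟩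
  · refine sum_mem fun n _ k => ?_
    rw [coeff_monomial]
    split_ifs
    · exact F.smul_mem _ (hp n)
    · exact zero_mem _
  · rw [derivative_sum]
    conv_rhs => rw [p.as_sum_support]
    refine Finset.sum_congr rfl fun n _ => ?_
    rw [derivative_monomial, Nat.add_sub_cancel]
    congr 1
    have h : (((n + 1 : ℕ) : R)) = algebraMap ℚ R ((n : ℚ) + 1) := by simp
    rw [h, ← Algebra.commutes, ← Algebra.smul_def, smul_smul, mul_inv_cancel₀ (by positivity),
      one_smul]
  · rw [finsetSum_coeff]
    exact Finset.sum_eq_zero fun n _ => by simp [coeff_monomial]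

theorem evalOne_eq_of_derivative_eq_zero {p : R[X]} (hp : derivative p = 0) :
    evalOne R p = p.coeff 0 := by
  have h : p = C (p.coeff 0) := by
    refine Polynomial.ext fun n => ?_
    rw [coeff_C]
    split_ifs with hn
    · rw [hn]
    obtain ⟨m, rfl⟩ := Nat.exists_eq_succ_of_ne_zero hn
    have := congrArg (fun q => (((m : ℚ) + 1)⁻¹) • q.coeff m) hp
    simp only [coeff_derivative, coeff_zero, smul_zero] at this
    have h : ((m : R) + 1) = algebraMap ℚ R ((m : ℚ) + 1) := by simp
    rwa [h, ← Algebra.commutes, ← Algebra.smul_def, smul_smul, inv_mul_cancel₀ (by positivity),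
      one_smul] at this
  conv_lhs => rw [h]
  exact evalOne_C _

theorem isNilpotent_mulLeft {p : R[X]} (hp : IsNilpotent p) :
    IsNilpotent (LinearMap.mulLeft ℚ p) := by
  obtain ⟨k, hk⟩ := hp
  exact ⟨k, by rw [LinearMap.pow_mulLeft, hk]; ext; simp⟩

theorem exp_mulLeft {p : R[X]} (hp : IsNilpotent p) :
    exp (LinearMap.mulLeft ℚ p) = LinearMap.mulLeft ℚ (exp p) := by
  exact (hp.map_exp (Algebra.lmul ℚ R[X])).symm

/-- A primitive polynomial differential equation `u' = y u`, transformed by `v = e^z u`: if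
`[z, [z, z']]` and `[z, y]` lie in a subspace `S` stable under `ad z`, then
`v' = (z' + y + s) v` for some `s ∈ S`. -/
theorem exists_derivative_exp_mul {z y u : R[X]} (hz : IsNilpotent z) (S : Submodule ℚ R[X])
    (hS : ∀ s ∈ S, z * s - s * z ∈ S) (hzz : z * derivative z - derivative z * z ∈ S)
    (hzy : z * y - y * z ∈ S) (hu : derivative u = y * u) :
    ∃ s ∈ S, derivative (exp z * u) = (derivative z + y + s) * (exp z * u) := by
  set ℓ : R[X] →ₗ[ℚ] Module.End ℚ R[X] := LinearMap.mul ℚ R[X] with hℓ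
  have hmul : ∀ p q, ℓ p * ℓ q = ℓ (p * q) := fun p q =>
    LinearMap.ext fun r => by simp [hℓ, mul_assoc]
  have hD : ∀ p, ℓ p * ddt R - ddt R * ℓ p = - ℓ (derivative p) := fun p => by
    rw [← neg_sub]; exact congrArg _ (ddt_mul_mulLeft p)
  have hstab : ∀ s ∈ S.map ℓ, ℓ z * s - s * ℓ z ∈ S.map ℓ := by
    rintro _ ⟨s, hs, rfl⟩
    exact ⟨_, hS s hs, by rw [map_sub, hmul, hmul]⟩
  have hn : IsNilpotent (ℓ z) := isNilpotent_mulLeft hz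
  -- `exp z` conjugates the operator `d/dt - y` to `d/dt - z' - y - s`
  have h1 := exp_conj_sub_mem hn (ddt R) (S.map ℓ) hstab (by
    rw [hD]
    refine ⟨_, neg_mem hzz, LinearMap.ext fun r => ?_⟩
    simp only [hℓ, LinearMap.mul_apply', LinearMap.sub_apply, Module.End.mul_apply,
      LinearMap.neg_apply]
    noncomm_ring)
  have h2 := exp_conj_sub_mem hn (ℓ y) (S.map ℓ) hstab (by
    refine hstab _ ⟨_, hzy, ?_⟩
    rw [map_sub, hmul, hmul])
  obtain ⟨s₁, hs₁, h1⟩ := h1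
  obtain ⟨s₂, hs₂, h2⟩ := h2
  have h3 : exp (ℓ z) * (ddt R - ℓ y) * exp (-ℓ z) =
      ddt R - ℓ (derivative z + y + (-s₁ + (z * y - y * z) + s₂)) := by
    rw [hD] at h1
    rw [hmul, hmul] at h2
    rw [mul_sub, sub_mul]
    rw [eq_sub_iff_add_eq] at h1 h2
    rw [← h1, ← h2]
    simp only [map_add, map_sub, map_neg]
    abel
  refine ⟨-s₁ + (z * y - y * z) + s₂, add_mem (add_mem (neg_mem hs₁) hzy) hs₂, ?_⟩
  have he : exp (ℓ z) = ℓ (exp z) := exp_mulLeft hz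
  have h4 : (exp (ℓ z) * (ddt R - ℓ y) * exp (-ℓ z)) (exp z * u) = 0 := by
    have h5 : exp (-ℓ z) (exp z * u) = u := by
      have : exp z * u = exp (ℓ z) u := by rw [he]; rfl
      rw [this, ← Module.End.mul_apply, exp_neg_mul_exp_self hn, Module.End.one_apply]
    rw [Module.End.mul_apply, h5, Module.End.mul_apply]
    have : (ddt R - ℓ y) u = 0 := by
      rw [LinearMap.sub_apply, ddt_apply, hu]; exact sub_self _
    rw [this, map_zero]
  rw [h3, LinearMap.sub_apply, sub_eq_zero] at h4
  exact h4

theorem coeff_zero_exp {z : R[X]} (hz : IsNilpotent z) (h0 : z.coeff 0 = 0) :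
    (exp z).coeff 0 = 1 := by
  have := hz.map_exp (constantCoeff (R := R))
  rw [constantCoeff_apply, constantCoeff_apply, h0, exp_zero] at this
  exact this

/-- A solution of `u' = y u`, where the coefficients of `y` lie in a nilpotent Lie algebra of
nilpotent elements, has `u(1) = ∏ e^{b_j} u(0)` with `b_j` in this Lie algebra. -/
theorem exists_prod_exp_of_derivative_eq (G : Submodule ℚ R) (J : ℕ → Submodule ℚ R)
    (hJ0 : J 0 = ⊤) (hJ : ∀ n, ∀ a ∈ G, ∀ b ∈ J n, a * b ∈ J (n + 1)) {M : ℕ} (hM : J M = ⊥)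
    (F : ℕ → Submodule ℚ R) (hFG : F 0 ≤ G) (hF : Antitone F)
    (hFF : ∀ k, ∀ a ∈ F k, ∀ b ∈ F k, a * b - b * a ∈ F (k + 1)) {N : ℕ} (hN : F N = ⊥)
    {y u : R[X]} (hy : y ∈ polySub (F 0)) (hu : derivative u = y * u) :
    ∃ l : List R, (∀ b ∈ l, b ∈ F 0) ∧ evalOne R u = (l.map exp).prod * u.coeff 0 := by
  have key : ∀ n k : ℕ, n + k = N → ∀ y u : R[X], y ∈ polySub (F k) → derivative u = y * u →
      ∃ l : List R, (∀ b ∈ l, b ∈ F 0) ∧ evalOne R u = (l.map exp).prod * u.coeff 0 := by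
    intro n
    induction n with
    | zero =>
      intro k hk y u hy hu
      rw [show k = N by omega, hN] at hy
      have hy0 : y = 0 := Polynomial.ext fun n => by simpa using hy n
      rw [hy0, zero_mul] at hu
      exact ⟨[], by simp, by simpa using evalOne_eq_of_derivative_eq_zero hu⟩
    | succ n ih =>
      intro k hk y u hy hu
      obtain ⟨Y, hY, hYy, hY0⟩ := exists_derivative_eq hy
      have hYn : IsNilpotent Y := isNilpotent_of_mem_polySub hJ0 hJ hM
        (polySub_mono ((hF (Nat.zero_le k)).trans hFG) hY)
      have hcomm : ∀ p ∈ polySub (F k), ∀ q ∈ polySub (F k),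
          p * q - q * p ∈ polySub (F (k + 1)) := fun p hp q hq =>
        commutator_mem_polySub (hFF k) hp hq
      have hY' : -Y ∈ polySub (F k) := neg_mem hY
      -- `exp (-Y) u` satisfies an equation with coefficients in the next member of the filtration
      obtain ⟨s, hs, hv⟩ := exists_derivative_exp_mul hYn.neg (polySub (F (k + 1)))
        (fun s hs => hcomm _ hY' _ (polySub_mono (hF (Nat.le_succ k)) hs))
        (by rw [derivative_neg, hYy]; exact hcomm _ hY' _ (neg_mem hy)) (hcomm _ hY' _ hy) hu
      rw [derivative_neg, hYy, neg_add_cancel, zero_add] at hv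
      obtain ⟨l, hl, hl'⟩ := ih (k + 1) (by omega) s _ hs hv
      refine ⟨evalOne R Y :: l, ?_, ?_⟩
      · intro b hb
        rcases List.mem_cons.1 hb with rfl | hb
        · exact hF (Nat.zero_le k) (evalOne_mem hY)
        · exact hl b hb
      · rw [map_mul, mul_coeff_zero, coeff_zero_exp hYn.neg (by simp [hY0]), one_mul] at hl'
        rw [List.map_cons, List.prod_cons, mul_assoc, ← hl', ← hYn.map_exp (evalOne R),
          ← mul_assoc, ← map_mul, exp_mul_exp_neg_self hYn, map_one, one_mul]
  exact key N 0 rfl y u hy hu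

/-- A weak form of the Baker-Campbell-Hausdorff formula: if the elements `a_i` of the Lie algebra
`G` have a sum in the ideal `F 0`, which contains the commutators, then `∏ e^{a_i}` is a product
of exponentials of elements of this ideal. -/
theorem exists_prod_exp_eq_of_sum_mem (G : Submodule ℚ R) (J : ℕ → Submodule ℚ R)
    (hJ0 : J 0 = ⊤) (hJ : ∀ n, ∀ a ∈ G, ∀ b ∈ J n, a * b ∈ J (n + 1)) {M : ℕ} (hM : J M = ⊥)
    (F : ℕ → Submodule ℚ R) (hFG : F 0 ≤ G) (hF : Antitone F)
    (hGG : ∀ a ∈ G, ∀ b ∈ G, a * b - b * a ∈ F 0)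
    (hFF : ∀ k, ∀ a ∈ F k, ∀ b ∈ F k, a * b - b * a ∈ F (k + 1)) {N : ℕ} (hN : F N = ⊥)
    (l : List R) (hl : ∀ a ∈ l, a ∈ G) (hsum : l.sum ∈ F 0) :
    ∃ l' : List R, (∀ b ∈ l', b ∈ F 0) ∧ (l.map exp).prod = (l'.map exp).prod := by
  -- `u(t) = ∏ e^{t a_i}` satisfies `u' = (∑ a_i + s) u` with `s` in the ideal
  have key : ∀ l : List R, (∀ a ∈ l, a ∈ G) → ∃ u : R[X], evalOne R u = (l.map exp).prod ∧
      u.coeff 0 = 1 ∧ ∃ s ∈ polySub (F 0), derivative u = (C l.sum + s) * u := by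
    intro l
    induction l with
    | nil => exact fun _ => ⟨1, by simp, by simp, 0, zero_mem _, by simp⟩
    | cons a l ih =>
      intro hl
      obtain ⟨w, hw1, hw0, s, hs, hw⟩ := ih fun b hb => hl b (List.mem_cons_of_mem a hb)
      have ha : a ∈ G := hl a List.mem_cons_self
      have hCG : ∀ b ∈ G, C b ∈ polySub G := fun b hb n => by
        rw [coeff_C]
        split_ifs
        · exact hb
        · exact zero_mem _
      have hz : C a * X ∈ polySub G := fun n => by
        rw [coeff_C_mul, coeff_X]
        split_ifs
        · simpa using ha
        · simp
      have hzn := isNilpotent_of_mem_polySub hJ0 hJ hM hz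
      have hsumG : l.sum ∈ G := list_sum_mem fun b hb =>
        hl b (List.mem_cons_of_mem a hb)
      have hcomm : ∀ p ∈ polySub G, ∀ q ∈ polySub G, p * q - q * p ∈ polySub (F 0) :=
        fun p hp q hq => commutator_mem_polySub hGG hp hq
      have hd : derivative (C a * X) = C a := by simp
      obtain ⟨s', hs', hv⟩ := exists_derivative_exp_mul hzn (polySub (F 0))
        (fun s hs => hcomm _ hz _ (polySub_mono hFG hs)) (by rw [hd]; exact hcomm _ hz _ (hCG a ha))
        (hcomm _ hz _ (add_mem (hCG _ hsumG) (polySub_mono hFG hs))) hw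
      refine ⟨exp (C a * X) * w, ?_, ?_, s + s', add_mem hs hs', ?_⟩
      · rw [map_mul, hw1, hzn.map_exp (evalOne R), map_mul, evalOne_C, evalOne_X, mul_one,
          List.map_cons, List.prod_cons]
      · rw [mul_coeff_zero, hw0, coeff_zero_exp hzn (by simp), one_mul]
      · rw [hv, hd, List.sum_cons, map_add]
        congr 1
        abel
  obtain ⟨u, hu1, hu0, s, hs, hu⟩ := key l hl
  have hC : C l.sum ∈ polySub (F 0) := fun n => by
    rw [coeff_C]
    split_ifs
    · exact hsum
    · exact zero_mem _
  obtain ⟨l', hl', h⟩ := exists_prod_exp_of_derivative_eq G J hJ0 hJ hM F hFG hF hFF hN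
    (add_mem hC hs) hu
  exact ⟨l', hl', by rw [← hu1, h, hu0, mul_one]⟩

end Poly

/-- The exponential of a derivation of a bilinear map is an automorphism of it. The reason is that
`f ⊗ 1` and `1 ⊗ f` commute, so that `exp (f ⊗ 1 + 1 ⊗ f) = exp f ⊗ exp f`. -/
theorem exp_bilinear {K V W : Type*} [Field K] [AddCommGroup V] [AddCommGroup W] [Module K V]
    [Module K W] [Module ℚ V] [Module ℚ W]
    (B : V →ₗ[K] V →ₗ[K] W) (f : Module.End K V) (g : Module.End K W)
    (hf : IsNilpotent f) (hg : IsNilpotent g)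
    (h : ∀ x y, g (B x y) = B (f x) y + B x (f y)) (x y : V) :
    exp g (B x y) = B (exp f x) (exp f y) := by
  let fL : Module.End K (V ⊗[K] V) := f.lTensor V
  let fR : Module.End K (V ⊗[K] V) := f.rTensor V
  have hL : IsNilpotent fL := hf.map <| Module.End.lTensorAlgHom K V V
  have hR : IsNilpotent fR := hf.map <| Module.End.rTensorAlgHom K V V
  have hc : Commute fL fR := by ext; simp [fL, fR]
  have h₁ : exp g (B x y) =
      TensorProduct.lift B (exp (fL + fR) (x ⊗ₜ[K] y)) := by
    have := Module.End.commute_exp_left_of_commute (hc.isNilpotent_add hL hR) hg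
      (g := TensorProduct.lift B) (by
        ext x y
        simp [fL, fR, h, add_comm])
    simpa using LinearMap.congr_fun this (x ⊗ₜ[K] y)
  have h₂ : exp fL = (exp f).lTensor V :=
    (hf.map_exp (Module.End.lTensorAlgHom K V V)).symm
  have h₃ : exp fR = (exp f).rTensor V :=
    (hf.map_exp (Module.End.rTensorAlgHom K V V)).symm
  rw [h₁, exp_add_of_commute hc hL hR, h₂, h₃]
  simp

end NilpExp

/-! ### The gauge action as an exponential -/

namespace DGLA

section affine

variable {K : Type u} [Field K] (N : DGLA.{u, v} K)

/-- The affine action of `N` on itself: `a` sends `(w, s)` to `([a, w] - s d a, 0)`. Elements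
`(w, 1)` stand for `w`, or for the operator `w + d` in `N ⊕ K d`. -/
noncomputable def affAd : N.carrier →ₗ[K] Module.End K (N.carrier × K) :=
  LinearMap.mk₂ K (fun a p => (N.bracket a p.1 - p.2 • N.d a, (0 : K)))
    (fun a b p => Prod.ext
      (by simp only [map_add, LinearMap.add_apply, smul_add, Prod.fst_add]; abel) (by simp))
    (fun c a p => Prod.ext
      (by simp only [map_smul, LinearMap.smul_apply, Prod.smul_fst, smul_sub]; rw [smul_comm])
      (by simp))
    (fun a p q => Prod.ext (by simp only [map_add, Prod.fst_add, Prod.snd_add, add_smul]; abel)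
      (by simp))
    (fun c a p => Prod.ext (by simp [smul_sub, mul_smul]) (by simp))

theorem affAd_apply (a : N.carrier) (p : N.carrier × K) :
    N.affAd a p = (N.bracket a p.1 - p.2 • N.d a, 0) := rfl

/-- In degree zero the bracket is antisymmetric. -/
theorem bracket_swap_of_gr_zero {a x : N.carrier} {n : ℤ} (ha : a ∈ N.gr 0) (hx : x ∈ N.gr n) :
    N.bracket x a = - N.bracket a x := by
  have := N.skew ha hx
  rw [zero_mul, zpow_zero, one_smul] at this
  exact eq_neg_of_add_eq_zero_right this

theorem bracket_comm_of_gr_one {x y : N.carrier} (hx : x ∈ N.gr 1) (hy : y ∈ N.gr 1) :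
    N.bracket x y = N.bracket y x := by
  have := N.skew hx hy
  rw [mul_one, zpow_one, neg_one_smul] at this
  exact add_neg_eq_zero.1 this

/-- An element of degree zero acts by derivations. -/
theorem jacobi_of_gr_zero {a : N.carrier} (ha : a ∈ N.gr 0) {n : ℤ} {x : N.carrier}
    (hx : x ∈ N.gr n) (y : N.carrier) :
    N.bracket a (N.bracket x y) = N.bracket (N.bracket a x) y + N.bracket x (N.bracket a y) := by
  refine N.toDGSpace.induction_gr (p := fun y => N.bracket a (N.bracket x y) =
    N.bracket (N.bracket a x) y + N.bracket x (N.bracket a y)) y (by simp) ?_ ?_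
  · intro y y' h h'
    simp only [map_add, h, h']
    abel
  · intro j y hy
    rw [N.jacobi ha hx hy, zero_mul, zpow_zero, one_smul]

theorem leibniz_of_gr_zero {a x : N.carrier} (ha : a ∈ N.gr 0) {n : ℤ} (hx : x ∈ N.gr n) :
    N.d (N.bracket a x) = N.bracket (N.d a) x + N.bracket a (N.d x) := by
  rw [N.leibniz ha hx, zpow_zero, one_smul]

theorem bracket_mem_gr_zero {a x : N.carrier} (ha : a ∈ N.gr 0) {n : ℤ} (hx : x ∈ N.gr n) :
    N.bracket a x ∈ N.gr n := by
  have := N.bracket_mem ha hx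
  rwa [zero_add] at this

theorem d_mem_gr_one {a : N.carrier} (ha : a ∈ N.gr 0) : N.d a ∈ N.gr 1 := N.d_mem ha

/-- On `N^0`, the affine action is a homomorphism of Lie algebras. -/
theorem affAd_bracket {a b : N.carrier} (ha : a ∈ N.gr 0) (hb : b ∈ N.gr 0) :
    N.affAd (N.bracket a b) = N.affAd a * N.affAd b - N.affAd b * N.affAd a := by
  refine LinearMap.ext fun p => Prod.ext ?_ ?_
  · simp only [LinearMap.sub_apply, Module.End.mul_apply, affAd_apply, Prod.fst_sub, zero_smul,
      sub_zero, map_sub, map_smul]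
    rw [N.jacobi_of_gr_zero ha hb, N.leibniz_of_gr_zero ha hb,
      N.bracket_swap_of_gr_zero hb (N.d_mem_gr_one ha), smul_add, smul_neg]
    abel
  · simp [affAd_apply]

theorem affAd_pow_succ (a : N.carrier) (n : ℕ) (p : N.carrier × K) :
    (N.affAd a ^ (n + 1)) p =
      (((N.bracket a : Module.End K N.carrier) ^ n) (N.bracket a p.1 - p.2 • N.d a), 0) := by
  induction n with
  | zero => rw [zero_add, pow_one, pow_zero]; rfl
  | succ n ih =>
    rw [pow_succ', Module.End.mul_apply, ih, affAd_apply, pow_succ', Module.End.mul_apply]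
    simp

/-- A descending filtration which makes all the operators `[x, ·]` uniformly nilpotent. -/
structure NilpFiltration (T : ℕ → Submodule K N.carrier) : Prop where
  top : T 0 = ⊤
  bracket_mem : ∀ (n : ℕ) (s t : N.carrier), t ∈ T n → N.bracket s t ∈ T (n + 1)
  antitone : Antitone T
  bot : ∃ M, T M = ⊥

variable {N} {T : ℕ → Submodule K N.carrier}

theorem NilpFiltration.ad_pow_eq_zero (hT : N.NilpFiltration T) :
    ∃ M, ∀ (a x : N.carrier), ((N.bracket a : Module.End K N.carrier) ^ M) x = 0 := by
  obtain ⟨M, hM⟩ := hT.bot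
  refine ⟨M, fun a x => ?_⟩
  have key : ∀ n, ((N.bracket a : Module.End K N.carrier) ^ n) x ∈ T n := by
    intro n
    induction n with
    | zero => rw [hT.top]; trivial
    | succ n ih => rw [pow_succ']; exact hT.bracket_mem n a _ ih
  have := key M
  rwa [hM, Submodule.mem_bot] at this

theorem NilpFiltration.isNilpotent_affAd (hT : N.NilpFiltration T) (a : N.carrier) :
    IsNilpotent (N.affAd a) := by
  obtain ⟨M, hM⟩ := hT.ad_pow_eq_zero
  refine ⟨M + 1, LinearMap.ext fun p => ?_⟩
  rw [affAd_pow_succ, hM]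
  rfl

end affine

section flow

variable {K : Type u} [Field K] [CharZero K]

/-- The underlying rational vector space, over which the exponential is defined. -/
noncomputable instance ratModule (N : DGLA.{u, v} K) : Module ℚ N.carrier :=
  Module.compHom N.carrier (algebraMap ℚ K)

variable (N : DGLA.{u, v} K)

/-- The exponential of the affine action of `a`; it is meaningful if `affAd a` is nilpotent. -/
noncomputable def flow (a : N.carrier) : Module.End K (N.carrier × K) :=
  IsNilpotent.exp (N.affAd a)

theorem flow_zero : N.flow 0 = 1 := by
  rw [flow, map_zero, IsNilpotent.exp_zero]

variable {N} {T : ℕ → Submodule K N.carrier} (hT : N.NilpFiltration T)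

include hT

theorem flow_neg_mul_flow (a : N.carrier) : N.flow (-a) * N.flow a = 1 := by
  rw [flow, flow, map_neg]
  exact IsNilpotent.exp_neg_mul_exp_self (hT.isNilpotent_affAd a)

/-- The gauge action is the exponential of the affine action. -/
theorem flow_apply_one (a w : N.carrier) : N.flow a (w, 1) = (N.gauge a w, 1) := by
  obtain ⟨M, hM⟩ := hT.ad_pow_eq_zero
  have hz : N.affAd a ^ (M + 1) = 0 := LinearMap.ext fun p => by
    rw [affAd_pow_succ, hM]; rfl
  have hM' : ∀ n, M ≤ n → ∀ x, ((N.bracket a : Module.End K N.carrier) ^ n) x = 0 := by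
    intro n hn x
    obtain ⟨m, rfl⟩ := Nat.exists_eq_add_of_le' hn
    rw [pow_add, Module.End.mul_apply, hM, map_zero]
  have hfin : N.gauge a w = w + ∑ n ∈ Finset.range M, ((Nat.factorial (n + 1) : ℕ) : K)⁻¹ •
      ((N.bracket a : Module.End K N.carrier) ^ n) (N.bracket a w - N.d a) := by
    rw [gauge]
    congr 1
    refine finsum_eq_sum_of_support_subset _ fun n hn => ?_
    rw [Finset.coe_range, Set.mem_Iio]
    by_contra h
    exact hn (by simp [hM' n (not_lt.1 h)])
  rw [flow, IsNilpotent.exp_eq_sum hz, Finset.sum_range_succ', hfin]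
  simp only [LinearMap.add_apply, LinearMap.sum_apply, LinearMap.smul_apply, affAd_pow_succ]
  refine Prod.ext ?_ ?_
  · simp only [Prod.fst_add, Prod.fst_sum, Prod.smul_fst, one_smul, pow_zero, Nat.factorial_zero,
      Nat.cast_one, inv_one, Module.End.one_apply]
    rw [add_comm]
    congr 1
    exact Finset.sum_congr rfl fun n _ => inv_natCast_smul_eq ℚ K _ _
  · simp [Prod.snd_sum]

/-- A subspace which is stable under `affAd a` is stable under its exponential. -/
theorem flow_mem {a : N.carrier} (W : Submodule K (N.carrier × K))
    (hW : ∀ p ∈ W, N.affAd a p ∈ W) {p : N.carrier × K} (hp : p ∈ W) : N.flow a p ∈ W := by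
  obtain ⟨M, hM⟩ := hT.isNilpotent_affAd a
  have hpow : ∀ n, (N.affAd a ^ n) p ∈ W := by
    intro n
    induction n with
    | zero => exact hp
    | succ n ih => rw [pow_succ', Module.End.mul_apply]; exact hW _ ih
  rw [flow, IsNilpotent.exp_eq_sum hM, LinearMap.sum_apply]
  refine sum_mem fun n _ => ?_
  rw [LinearMap.smul_apply, inv_natCast_smul_eq ℚ K]
  exact W.smul_mem _ (hpow n)

theorem gauge_mem_gr_one {a w : N.carrier} (ha : a ∈ N.gr 0) (hw : w ∈ N.gr 1) :
    N.gauge a w ∈ N.gr 1 := by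
  have := flow_mem hT (a := a) ((N.gr 1).prod ⊤) (fun p hp => ⟨sub_mem
    (N.bracket_mem_gr_zero ha hp.1) (Submodule.smul_mem _ _ (N.d_mem_gr_one ha)), trivial⟩)
    (p := (w, 1)) ⟨hw, trivial⟩
  rw [flow_apply_one hT] at this
  exact this.1

end flow

end DGLA

/-! ### Maurer-Cartan elements and their gauge equivalence -/

namespace DGLA

variable {K : Type u} [Field K]

theorem proj_one_bracket (N : DGLA.{u, v} K) {a : N.carrier} (ha : a ∈ N.gr 0) (x : N.carrier) :
    N.toDGSpace.proj 1 (N.bracket a x) = N.bracket a (N.toDGSpace.proj 1 x) := by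
  refine N.toDGSpace.induction_gr (p := fun x => N.toDGSpace.proj 1 (N.bracket a x) =
    N.bracket a (N.toDGSpace.proj 1 x)) x (by simp) (fun x y hx hy => by
      simp only [map_add, hx, hy]) ?_
  intro i x hx
  by_cases h : i = 1
  · subst h
    rw [N.toDGSpace.proj_same hx, N.toDGSpace.proj_same (N.bracket_mem_gr_zero ha hx)]
  · rw [N.toDGSpace.proj_ne hx h, N.toDGSpace.proj_ne (N.bracket_mem_gr_zero ha hx) h, map_zero]

/-- The symmetric bilinear form of the curvature, on the elements `w + s d` with `w` of degree
one: `[w + s d, w' + s' d] = [w, w'] + s d w' + s' d w`. -/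
noncomputable def curvature (N : DGLA.{u, v} K) :
    N.carrier × K →ₗ[K] N.carrier × K →ₗ[K] N.carrier :=
  LinearMap.mk₂ K (fun p q => N.bracket (N.toDGSpace.proj 1 p.1) (N.toDGSpace.proj 1 q.1) +
      p.2 • N.d (N.toDGSpace.proj 1 q.1) + q.2 • N.d (N.toDGSpace.proj 1 p.1))
    (fun p p' q => by
      simp only [Prod.fst_add, Prod.snd_add, map_add, LinearMap.add_apply, add_smul, smul_add]
      abel)
    (fun c p q => by
      simp only [Prod.smul_fst, Prod.smul_snd, map_smul, LinearMap.smul_apply, smul_add,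
        smul_eq_mul, mul_smul]
      rw [smul_comm c q.2])
    (fun p q q' => by
      simp only [Prod.fst_add, Prod.snd_add, map_add, add_smul, smul_add]
      abel)
    (fun c p q => by
      simp only [Prod.smul_fst, Prod.smul_snd, map_smul, smul_add, smul_eq_mul, mul_smul]
      rw [smul_comm c p.2])

theorem curvature_apply (N : DGLA.{u, v} K) (p q : N.carrier × K) : N.curvature p q =
    N.bracket (N.toDGSpace.proj 1 p.1) (N.toDGSpace.proj 1 q.1) +
      p.2 • N.d (N.toDGSpace.proj 1 q.1) + q.2 • N.d (N.toDGSpace.proj 1 p.1) := rfl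

/-- Elements of degree zero act as derivations of the curvature form. -/
theorem bracket_curvature (N : DGLA.{u, v} K) {a : N.carrier} (ha : a ∈ N.gr 0)
    (p q : N.carrier × K) : N.bracket a (N.curvature p q) =
      N.curvature (N.affAd a p) q + N.curvature p (N.affAd a q) := by
  have hp := N.toDGSpace.proj_mem 1 p.1
  have hq := N.toDGSpace.proj_mem 1 q.1
  simp only [curvature_apply, affAd_apply, map_sub, map_smul, zero_smul, map_add,
    N.proj_one_bracket ha, N.toDGSpace.proj_same (N.d_mem_gr_one ha), N.d_d, smul_zero,
    LinearMap.sub_apply, LinearMap.smul_apply, N.jacobi_of_gr_zero ha hp,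
    N.leibniz_of_gr_zero ha hp, N.leibniz_of_gr_zero ha hq,
    N.bracket_comm_of_gr_one hp (N.d_mem_gr_one ha), sub_zero, add_zero]
  rw [smul_add, smul_add]
  abel

/-- For `x` of degree one, Jacobi's identity reads `3 [x, [x, x]] = 0`. -/
theorem bracket_bracket_self [CharZero K] (N : DGLA.{u, v} K) {x : N.carrier} (hx : x ∈ N.gr 1) :
    N.bracket x (N.bracket x x) = 0 := by
  have h1 := N.jacobi hx hx hx
  have h2 := N.skew hx (N.bracket_mem hx hx)
  rw [show (1 : ℤ) * (1 + 1) = 2 by norm_num, show (-1 : K) ^ (2 : ℤ) = 1 by norm_num,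
    one_smul] at h2
  rw [eq_neg_of_add_eq_zero_right h2, mul_one, zpow_one, neg_one_smul] at h1
  have h3 : (3 : K) • N.bracket x (N.bracket x x) = 0 := by
    rw [show (3 : K) = 1 + 1 + 1 by norm_num, add_smul, add_smul, one_smul]
    nth_rewrite 1 [h1]
    abel
  exact (smul_eq_zero_iff_right three_ne_zero).1 h3

/-- The Maurer-Cartan elements are the elements of degree one whose curvature vanishes. -/
theorem mem_MC_iff [CharZero K] (N : DGLA.{u, v} K) {x : N.carrier} :
    x ∈ N.MC ↔ x ∈ N.gr 1 ∧ N.curvature (x, 1) (x, 1) = 0 := by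
  refine and_congr_right fun hx => ?_
  have h : N.curvature (x, 1) (x, 1) = (2 : K) • (N.d x + (1 / 2 : K) • N.bracket x x) := by
    rw [curvature_apply]
    simp only [N.toDGSpace.proj_same hx, one_smul]
    rw [smul_add, smul_smul, mul_one_div_cancel two_ne_zero, one_smul, two_smul]
    abel
  rw [h, smul_eq_zero_iff_right two_ne_zero]

theorem neg_mem_of_mem_map_neg_reverse {N : DGLA.{u, v} K} {S : Submodule K N.carrier}
    {l : List N.carrier} (hl : ∀ a ∈ l, a ∈ S) : ∀ a ∈ (l.map Neg.neg).reverse, a ∈ S := by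
  intro a ha
  rw [List.mem_reverse, List.mem_map] at ha
  obtain ⟨b, hb, rfl⟩ := ha
  exact neg_mem (hl b hb)

theorem stabilizer_mem {N : DGLA.{u, v} K} {x e : N.carrier} (hx : x ∈ N.MC) (he : e ∈ N.gr (-1)) :
    N.d e + N.bracket x e ∈ N.gr 0 :=
  add_mem (N.d_mem he) (N.bracket_mem hx.1 he)

/-- The elements `d e + [x, e]` of the irrelevant stabilizer fix the Maurer-Cartan element `x`. -/
theorem affAd_stabilizer [CharZero K] {N : DGLA.{u, v} K} {x e : N.carrier}
    (hx : x ∈ N.MC) (he : e ∈ N.gr (-1)) :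
    N.affAd (N.d e + N.bracket x e) (x, 1) = 0 := by
  have hx1 := hx.1
  have hxe : N.bracket x e ∈ N.gr 0 := N.bracket_mem hx1 he
  have hde : N.d e ∈ N.gr 0 := N.d_mem he
  have hdx : N.bracket x x = -((2 : K) • N.d x) := by
    have := congrArg ((2 : K) • ·) hx.2
    simp only [smul_add, smul_zero, smul_smul] at this
    rw [mul_one_div_cancel two_ne_zero, one_smul] at this
    exact eq_neg_of_add_eq_zero_right this
  have hj := N.jacobi hx1 hx1 he
  rw [mul_one, zpow_one, neg_one_smul, hdx, ← sub_eq_iff_eq_add, sub_neg_eq_add] at hj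
  have hj' : N.bracket x (N.bracket x e) = -N.bracket (N.d x) e := by
    rw [← two_smul K, map_neg, map_smul, LinearMap.neg_apply, LinearMap.smul_apply,
      ← smul_neg] at hj
    exact smul_right_injective _ two_ne_zero hj
  refine Prod.ext ?_ rfl
  rw [affAd_apply]
  simp only [map_add, LinearMap.add_apply, one_smul, Prod.fst_zero, N.d_d, zero_add,
    N.leibniz hx1 he, zpow_one, neg_one_smul]
  have h1 := N.bracket_swap_of_gr_zero hxe hx1
  have h2 := N.bracket_swap_of_gr_zero hde hx1
  rw [hj'] at h1
  rw [h2, ← neg_eq_iff_eq_neg.2 h1]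
  abel

/-- The operators on `N × K` with values in the subspace `W`. -/
def operatorsInto (N : DGLA.{u, v} K) (W : Submodule K (N.carrier × K)) :
    Submodule K (Module.End K (N.carrier × K)) where
  carrier := {f | ∀ p, f p ∈ W}
  add_mem' hf hg p := add_mem (hf p) (hg p)
  zero_mem' _ := zero_mem W
  smul_mem' c _ hf p := W.smul_mem c (hf p)

/-- The filtration of `N × K` induced by a filtration `T` of `N`, shifted by one so that `N × K`
itself can be its first member. -/
def affFiltration (N : DGLA.{u, v} K) (T : ℕ → Submodule K N.carrier) :
    ℕ → Submodule K (N.carrier × K)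
  | 0 => ⊤
  | n + 1 => (T n).prod ⊥

theorem NilpFiltration.affAd_mem {N : DGLA.{u, v} K} {T : ℕ → Submodule K N.carrier}
    (hT : N.NilpFiltration T) (a : N.carrier) {n : ℕ} {p : N.carrier × K}
    (hp : p ∈ affFiltration N T n) : N.affAd a p ∈ affFiltration N T (n + 1) := by
  refine ⟨?_, rfl⟩
  rw [affAd_apply]
  cases n with
  | zero => rw [hT.top]; trivial
  | succ n =>
    rw [show p.2 = 0 from hp.2, zero_smul, sub_zero]
    exact hT.bracket_mem n a _ hp.1

variable [CharZero K]

section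

variable {N : DGLA.{u, v} K} {T : ℕ → Submodule K N.carrier} (hT : N.NilpFiltration T)

include hT

/-- The gauge action preserves the Maurer-Cartan equation. -/
theorem gauge_mem_MC {a x : N.carrier} (ha : a ∈ N.gr 0) (hx : x ∈ N.MC) : N.gauge a x ∈ N.MC := by
  rw [mem_MC_iff] at hx ⊢
  refine ⟨gauge_mem_gr_one hT ha hx.1, ?_⟩
  obtain ⟨M, hM⟩ := hT.ad_pow_eq_zero
  have hg : IsNilpotent (N.bracket a : Module.End K N.carrier) := ⟨M, LinearMap.ext fun x => hM a x⟩
  have := NilpExp.exp_bilinear N.curvature (N.affAd a) (N.bracket a) (hT.isNilpotent_affAd a) hg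
    (N.bracket_curvature ha) (x, 1) (x, 1)
  rw [hx.2, map_zero] at this
  rw [← flow_apply_one hT]
  exact this.symm

/-- A product of exponentials maps a Maurer-Cartan element to a gauge equivalent one. -/
theorem flow_prod_mem_MC (l : List N.carrier) (hl : ∀ a ∈ l, a ∈ N.gr 0) {x : N.carrier}
    (hx : x ∈ N.MC) : ∃ y : N.MC, (l.map N.flow).prod (x, 1) = (y.1, 1) ∧
      (Quot.mk N.GaugeEquiv ⟨x, hx⟩ : Quot N.GaugeEquiv) = Quot.mk _ y := by
  induction l with
  | nil => exact ⟨⟨x, hx⟩, rfl, rfl⟩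
  | cons a l ih =>
    obtain ⟨y, hy, hxy⟩ := ih fun b hb => hl b (List.mem_cons_of_mem a hb)
    have ha := hl a List.mem_cons_self
    refine ⟨⟨N.gauge a y, gauge_mem_MC hT ha y.2⟩, ?_, hxy.trans (Quot.sound ⟨a, ha, rfl⟩)⟩
    rw [List.map_cons, List.prod_cons, Module.End.mul_apply, hy, flow_apply_one hT]

/-- The inverse of `∏ e^{a_i}` is the product of the `e^{-a_i}` in the reverse order. -/
theorem flow_prod_neg_reverse_mul (l : List N.carrier) :
    (((l.map Neg.neg).reverse).map N.flow).prod * (l.map N.flow).prod = 1 := by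
  induction l with
  | nil => simp
  | cons a l ih =>
    simp only [List.map_cons, List.reverse_cons, List.map_append, List.prod_append,
      List.prod_cons, List.map_nil, List.prod_nil, mul_one]
    rw [mul_assoc, ← mul_assoc (N.flow (-a)), flow_neg_mul_flow hT, one_mul]
    exact ih

theorem flow_prod_neg_reverse_apply (l : List N.carrier) (p : N.carrier × K) :
    (((l.map Neg.neg).reverse).map N.flow).prod ((l.map N.flow).prod p) = p := by
  rw [← Module.End.mul_apply, flow_prod_neg_reverse_mul hT, Module.End.one_apply]

/-- Two Maurer-Cartan elements have the same class if and only if they are related by a product of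
exponentials. -/
theorem mk_eq_mk_iff (x y : N.MC) :
    (Quot.mk N.GaugeEquiv x : Quot N.GaugeEquiv) = Quot.mk _ y ↔
      ∃ l : List N.carrier, (∀ a ∈ l, a ∈ N.gr 0) ∧ (l.map N.flow).prod (x.1, 1) = (y.1, 1) := by
  constructor
  · intro h
    rw [Quot.eq] at h
    induction h with
    | rel x y h =>
      obtain ⟨a, ha, h⟩ := h
      refine ⟨[a], by simpa using ha, ?_⟩
      simp [flow_apply_one hT, h]
    | refl x => exact ⟨[], by simp, by simp⟩
    | symm x y _ ih =>
      obtain ⟨l, hl, h⟩ := ih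
      refine ⟨(l.map Neg.neg).reverse, neg_mem_of_mem_map_neg_reverse hl, ?_⟩
      rw [← h, flow_prod_neg_reverse_apply hT]
    | trans x y z _ _ ih ih' =>
      obtain ⟨l, hl, h⟩ := ih
      obtain ⟨l', hl', h'⟩ := ih'
      refine ⟨l' ++ l, fun a ha => (List.mem_append.1 ha).elim (hl' a) (hl a), ?_⟩
      rw [List.map_append, List.prod_append, Module.End.mul_apply, h, h']
  · rintro ⟨l, hl, h⟩
    obtain ⟨y', hy', hxy⟩ := flow_prod_mem_MC hT l hl x.2
    rw [h] at hy'
    rw [show y = y' from Subtype.ext (congrArg Prod.fst hy')]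
    exact hxy

/-- If `𝔥` is a subspace of `N^0` which contains all brackets, then a product of exponentials of
elements of `N^0` whose sum lies in `𝔥` is a product of exponentials of elements of `𝔥`. -/
theorem exists_flow_prod_eq_of_sum_mem (𝔥 : Submodule K N.carrier) (h𝔥 : 𝔥 ≤ N.gr 0)
    (hbr : ∀ a ∈ N.gr 0, ∀ b ∈ N.gr 0, N.bracket a b ∈ 𝔥) (l : List N.carrier)
    (hl : ∀ a ∈ l, a ∈ N.gr 0) (hsum : l.sum ∈ 𝔥) :
    ∃ l' : List N.carrier, (∀ a ∈ l', a ∈ 𝔥) ∧ (l.map N.flow).prod = (l'.map N.flow).prod := by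
  let G : Submodule ℚ (Module.End K (N.carrier × K)) := ((N.gr 0).map N.affAd).restrictScalars ℚ
  let F : ℕ → Submodule ℚ (Module.End K (N.carrier × K)) := fun k =>
    ((𝔥 ⊓ T k).map N.affAd).restrictScalars ℚ
  obtain ⟨M, hM⟩ := hT.bot
  let J : ℕ → Submodule ℚ (Module.End K (N.carrier × K)) := fun n =>
    (operatorsInto N (affFiltration N T n)).restrictScalars ℚ
  have hJ0 : J 0 = ⊤ := eq_top_iff.2 fun f _ p => Submodule.mem_top
  have hJ : ∀ n, ∀ f ∈ G, ∀ g ∈ J n, f * g ∈ J (n + 1) := by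
    rintro n _ ⟨a, -, rfl⟩ g hg p
    exact hT.affAd_mem a (hg p)
  have hJM : J (M + 1) = ⊥ := by
    rw [eq_bot_iff]
    intro f hf
    refine LinearMap.ext fun p => ?_
    have : f p ∈ (T M).prod ⊥ := hf p
    rw [hM] at this
    exact Prod.ext this.1 this.2
  have hl1 : ∀ f ∈ l.map N.affAd, f ∈ G := by
    intro f hf
    obtain ⟨a, ha, rfl⟩ := List.mem_map.1 hf
    exact ⟨a, hl a ha, rfl⟩
  have hcomm : ∀ a b, a ∈ N.gr 0 → b ∈ N.gr 0 → ∀ k, N.bracket a b ∈ 𝔥 ⊓ T k →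
      N.affAd a * N.affAd b - N.affAd b * N.affAd a ∈ F k := fun a b ha hb k hk =>
    ⟨_, hk, N.affAd_bracket ha hb⟩
  obtain ⟨l', hl', h⟩ := NilpExp.exists_prod_exp_eq_of_sum_mem G J hJ0 hJ hJM F
    (Submodule.map_mono (inf_le_left.trans h𝔥))
    (fun k k' hk => Submodule.map_mono (inf_le_inf_left _ (hT.antitone hk)))
    (by
      rintro _ ⟨a, ha, rfl⟩ _ ⟨b, hb, rfl⟩
      exact hcomm a b ha hb 0 ⟨hbr a ha b hb, by rw [hT.top]; trivial⟩)
    (by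
      rintro k _ ⟨a, ha, rfl⟩ _ ⟨b, hb, rfl⟩
      exact hcomm a b (h𝔥 ha.1) (h𝔥 hb.1) _
        ⟨hbr a (h𝔥 ha.1) b (h𝔥 hb.1), hT.bracket_mem k a b hb.2⟩)
    (N := M) (by
      rw [eq_bot_iff]
      rintro _ ⟨a, ha, rfl⟩
      rw [show a = 0 by simpa [hM] using ha.2, map_zero]
      rfl)
    (l.map N.affAd) hl1
    (show _ ∈ (𝔥 ⊓ T 0).map N.affAd from
      ⟨l.sum, ⟨hsum, by rw [hT.top]; trivial⟩, by rw [map_list_sum]⟩)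
  have hlift : ∀ l' : List (Module.End K (N.carrier × K)), (∀ f ∈ l', f ∈ F 0) →
      ∃ l'' : List N.carrier, (∀ a ∈ l'', a ∈ 𝔥) ∧ l''.map N.affAd = l' := by
    intro l'
    induction l' with
    | nil => exact fun _ => ⟨[], by simp, rfl⟩
    | cons f l' ih =>
      intro hl'
      obtain ⟨l'', h1, rfl⟩ := ih fun g hg => hl' g (List.mem_cons_of_mem f hg)
      obtain ⟨a, ha, rfl⟩ := hl' f List.mem_cons_self
      refine ⟨a :: l'', ?_, rfl⟩
      intro b hb
      rcases List.mem_cons.1 hb with rfl | hb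
      · exact ha.1
      · exact h1 b hb
  obtain ⟨l'', hl'', rfl⟩ := hlift l' hl'
  refine ⟨l'', hl'', ?_⟩
  rw [List.map_map, List.map_map] at h
  exact h

theorem flow_eq_self {a : N.carrier} {p : N.carrier × K} (h : N.affAd a p = 0) :
    N.flow a p = p := by
  obtain ⟨M, hM⟩ := hT.isNilpotent_affAd a
  have hM' : N.affAd a ^ (M + 1) = 0 := by rw [pow_succ, hM, zero_mul]
  rw [flow, IsNilpotent.exp_eq_sum hM', Finset.sum_range_succ', LinearMap.add_apply,
    LinearMap.sum_apply, Finset.sum_eq_zero, zero_add]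
  · simp
  · intro n _
    rw [LinearMap.smul_apply, pow_succ, Module.End.mul_apply, h, map_zero, smul_zero]

theorem flow_neg_stabilizer {x e : N.carrier} (hx : x ∈ N.MC) (he : e ∈ N.gr (-1)) :
    N.flow (-(N.d e + N.bracket x e)) (x, 1) = (x, 1) :=
  flow_eq_self hT (by
    rw [map_neg, LinearMap.neg_apply, affAd_stabilizer hx he, neg_zero])

end

end DGLA

/-! ### Tensor products with algebras, fibre products and acyclic complexes -/

namespace DGSpace

variable {K : Type u} [Field K]

/-- Linear maps of degree `k` commute with the projections to the components. -/
theorem map_proj_of_map_gr {V : DGSpace.{u, v} K} {W : DGSpace.{u, w} K}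
    (f : V.carrier →ₗ[K] W.carrier) {k : ℤ} (hf : ∀ i, ∀ x ∈ V.gr i, f x ∈ W.gr (i + k)) (i : ℤ)
    (x : V.carrier) : f (V.proj i x) = W.proj (i + k) (f x) := by
  refine V.induction_gr (p := fun x => f (V.proj i x) = W.proj (i + k) (f x)) x (by simp)
    (fun x y hx hy => by simp only [map_add, hx, hy]) ?_
  intro j x hx
  by_cases h : j = i
  · subst h
    rw [V.proj_same hx, W.proj_same (hf j x hx)]
  · rw [V.proj_ne hx h, W.proj_ne (hf j x hx) (by omega), map_zero]

theorem parity_parity (V : DGSpace.{u, v} K) (x : V.carrier) : V.parity (V.parity x) = x := by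
  refine V.induction_gr (p := fun x => V.parity (V.parity x) = x) x (by simp)
    (fun x y hx hy => by simp only [map_add, hx, hy]) ?_
  intro i x hx
  rw [V.parity_of_mem hx, map_smul, V.parity_of_mem hx, smul_smul, ← zpow_add₀ (by simp),
    (Even.add_self i).neg_one_zpow, one_smul]

theorem d_parity (V : DGSpace.{u, v} K) (x : V.carrier) : V.d (V.parity x) = -V.parity (V.d x) := by
  refine V.induction_gr (p := fun x => V.d (V.parity x) = -V.parity (V.d x)) x (by simp)
    (fun x y hx hy => by simp only [map_add, hx, hy, neg_add]) ?_
  intro i x hx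
  rw [V.parity_of_mem hx, V.parity_of_mem (V.d_mem hx), map_smul, zpow_add₀ (by simp)]
  simp

/-- An acyclic complex of vector spaces has a contracting homotopy. -/
theorem Acyclic.exists_contraction {V : DGSpace.{u, v} K} (hV : V.Acyclic) :
    ∃ s : V.carrier →ₗ[K] V.carrier, (∀ i, ∀ x ∈ V.gr i, s x ∈ V.gr (i - 1)) ∧
      ∀ x, V.d (s x) + s (V.d x) = x := by
  obtain ⟨g, hg⟩ := V.d.rangeRestrict.exists_rightInverse_of_surjective
    (LinearMap.range_eq_top.2 V.d.surjective_rangeRestrict)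
  obtain ⟨s₀, hs₀⟩ := LinearMap.exists_extend g
  have h0 : ∀ x, V.d x = 0 → V.d (s₀ x) = x := by
    intro x hx
    obtain ⟨y, rfl⟩ := hV x hx
    have h1 : s₀ (V.d y) = g (V.d.rangeRestrict y) := LinearMap.congr_fun hs₀ (V.d.rangeRestrict y)
    rw [h1]
    exact congrArg Subtype.val (LinearMap.congr_fun hg (V.d.rangeRestrict y))
  -- the component of degree `-1` of the section `s₀` of `d`
  let s₁ : V.carrier →ₗ[K] V.carrier := V.gradedMap fun i => V.proj (i - 1) ∘ₗ s₀
  have hs₁ : ∀ i, ∀ x ∈ V.gr i, s₁ x = V.proj (i - 1) (s₀ x) := fun i x hx =>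
    V.gradedMap_of_mem _ hx
  have hdeg : ∀ i, ∀ x ∈ V.gr i, s₁ x ∈ V.gr (i - 1) := fun i x hx => by
    rw [hs₁ i x hx]; exact V.proj_mem _ _
  have hgr : ∀ i, ∀ x ∈ V.gr i, V.d x = 0 → V.d (s₁ x) = x := by
    intro i x hx hdx
    rw [hs₁ i x hx, map_proj_of_map_gr V.d (k := 1) (fun _ _ h => V.d_mem h), h0 x hdx,
      sub_add_cancel, V.proj_same hx]
  have h1 : ∀ x, V.d (s₁ (V.d x)) = V.d x := by
    intro x
    refine V.induction_gr (p := fun x => V.d (s₁ (V.d x)) = V.d x) x (by simp)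
      (fun x y hx hy => by simp only [map_add, hx, hy]) ?_
    exact fun i x hx => hgr (i + 1) _ (V.d_mem hx) (V.d_d x)
  have h2 : ∀ x, V.d x = 0 → V.d (s₁ x) = x := by
    intro x hx
    obtain ⟨y, rfl⟩ := hV x hx
    exact h1 y
  -- `d s₁` is the identity on cocycles; applied to the cocycle `x - s₁ (d x)`, this gives
  -- `x = d (s₁ x) + s₁ (d x) - d (s₁ (s₁ (d x)))`
  refine ⟨s₁ - V.d ∘ₗ s₁ ∘ₗ s₁, ?_, fun x => ?_⟩
  · intro i x hx
    refine sub_mem (hdeg i x hx) ?_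
    have := V.d_mem (hdeg _ _ (hdeg i x hx))
    rwa [sub_add_cancel] at this
  · have h3 := h2 (x - s₁ (V.d x)) (by rw [map_sub, h1, sub_self])
    simp only [map_sub, LinearMap.sub_apply, LinearMap.comp_apply, V.d_d, sub_zero] at h3 ⊢
    rw [add_sub, add_sub_right_comm, h3, sub_add_cancel]

end DGSpace

theorem mulPow_antitone {K : Type u} [Field K] {V : Type w} [AddCommGroup V]
    [Module K V] (m : V →ₗ[K] V →ₗ[K] V) :
    Antitone (mulPow m) := by
  refine antitone_nat_of_succ_le fun n => ?_
  induction n with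
  | zero => exact le_top
  | succ n ih => exact Submodule.map₂_le_map₂_right ih

namespace DGLA

variable {K : Type u} [Field K] (L : DGLA.{u, v} K)

/-- The powers of `A` filter `L ⊗ A`. -/
theorem nilpFiltration_tensorPow (A : NilpDGA.{u, w} K) :
    (L.tensor A).NilpFiltration (tensorPow L A) where
  top := by
    refine eq_top_iff.2 fun t _ => ?_
    change L.carrier ⊗[K] A.carrier at t
    induction t using TensorProduct.induction_on with
    | zero => exact zero_mem _
    | add s s' h h' => exact add_mem (h trivial) (h' trivial)
    | tmul x a => exact Submodule.subset_span ⟨x, a, Submodule.mem_top, rfl⟩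
  bracket_mem := bracket_mem_tensorPow L A
  antitone := fun n m h => Submodule.span_mono fun _ ⟨x, a, ha, e⟩ =>
    ⟨x, a, mulPow_antitone A.mul h ha, e⟩
  bot := by
    obtain ⟨M, hM⟩ := A.nilpotent
    refine ⟨M, ?_⟩
    rw [tensorPow, Submodule.span_eq_bot]
    rintro t ⟨x, a, ha, rfl⟩
    rw [hM, Submodule.mem_bot] at ha
    rw [ha, TensorProduct.tmul_zero]

variable {L} {A B C : NilpDGA.{u, w} K}

theorem tensorMap_tmul (f : A ⟶ B) (x : L.carrier) (a : A.carrier) :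
    L.tensorMap f (x ⊗ₜ[K] a) = x ⊗ₜ[K] f.toLin a := rfl

theorem tensorMap_comp (f : A ⟶ B) (g : B ⟶ C) (t : (L.tensor A).carrier) :
    L.tensorMap (f ≫ g) t = L.tensorMap g (L.tensorMap f t) :=
  LinearMap.congr_fun (TensorProduct.map_comp (LinearMap.id (R := K) (M := L.carrier)) g.toLin
    LinearMap.id f.toLin) t

theorem tensorMap_proj (f : A ⟶ B) (n : ℤ) (t : (L.tensor A).carrier) :
    L.tensorMap f ((L.tensor A).toDGSpace.proj n t) =
      (L.tensor B).toDGSpace.proj n (L.tensorMap f t) := by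
  have := DGSpace.map_proj_of_map_gr (V := (L.tensor A).toDGSpace) (W := (L.tensor B).toDGSpace)
    (L.tensorMap f) (k := 0) (fun i x hx => by rw [add_zero]; exact L.tensorMap_gr f hx) n t
  rwa [add_zero] at this

/-- Homogeneous elements can be lifted along surjective morphisms to elements of the same degree. -/
theorem exists_tensorMap_eq {f : A ⟶ B} (hf : Function.Surjective f.toLin) {n : ℤ}
    {t : (L.tensor B).carrier} (ht : t ∈ (L.tensor B).gr n) :
    ∃ s ∈ (L.tensor A).gr n, L.tensorMap f s = t := by
  obtain ⟨s, hs⟩ := LinearMap.lTensor_surjective L.carrier hf t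
  refine ⟨(L.tensor A).toDGSpace.proj n s, (L.tensor A).toDGSpace.proj_mem n s, ?_⟩
  rw [tensorMap_proj, ← (L.tensor B).toDGSpace.proj_same ht]
  exact congrArg _ hs

section fiber

variable {α : A ⟶ C} {β : B ⟶ C}

/-- The inclusion `L ⊗ (A ×_C B) → L ⊗ (A × B)`. -/
noncomputable def fiberIncl (α : A ⟶ C) (β : B ⟶ C) :
    L.carrier ⊗[K] (NilpDGA.fiberProd α β).carrier →ₗ[K]
      L.carrier ⊗[K] (A.carrier × B.carrier) :=
  LinearMap.lTensor L.carrier (NilpDGA.fiberSubmodule α β).subtype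

theorem prodRight_fiberIncl (t : L.carrier ⊗[K] (NilpDGA.fiberProd α β).carrier) :
    TensorProduct.prodRight K K L.carrier A.carrier B.carrier (fiberIncl α β t) =
      (L.tensorMap (NilpDGA.fiberFst α β) t, L.tensorMap (NilpDGA.fiberSnd α β) t) := by
  induction t using TensorProduct.induction_on with
  | zero => simp only [map_zero]; rfl
  | add s t hs ht => rw [map_add, map_add, hs, ht, map_add, map_add]; rfl
  | tmul x a => exact TensorProduct.prodRight_tmul K K _ _ _ x a.1

/-- `L ⊗ (A ×_C B) → (L ⊗ A) × (L ⊗ B)` is injective. -/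
theorem fiber_tensor_ext {t t' : (L.tensor (NilpDGA.fiberProd α β)).carrier}
    (h₁ : L.tensorMap (NilpDGA.fiberFst α β) t = L.tensorMap (NilpDGA.fiberFst α β) t')
    (h₂ : L.tensorMap (NilpDGA.fiberSnd α β) t = L.tensorMap (NilpDGA.fiberSnd α β) t') :
    t = t' := by
  have hinj : Function.Injective (fiberIncl (L := L) α β) :=
    Module.Flat.lTensor_preserves_injective_linearMap _ (Submodule.injective_subtype _)
  refine hinj ((TensorProduct.prodRight K K L.carrier A.carrier B.carrier).injective ?_)
  rw [prodRight_fiberIncl, prodRight_fiberIncl, h₁, h₂]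

/-- `L ⊗ (A ×_C B) = (L ⊗ A) ×_{L ⊗ C} (L ⊗ B)`, in each degree. -/
theorem exists_fiber_tensor {n : ℤ} {x : (L.tensor A).carrier} {y : (L.tensor B).carrier}
    (hx : x ∈ (L.tensor A).gr n) (hy : y ∈ (L.tensor B).gr n)
    (h : L.tensorMap α x = L.tensorMap β y) :
    ∃ t ∈ (L.tensor (NilpDGA.fiberProd α β)).gr n,
      L.tensorMap (NilpDGA.fiberFst α β) t = x ∧ L.tensorMap (NilpDGA.fiberSnd α β) t = y := by
  let e := TensorProduct.prodRight K K L.carrier A.carrier B.carrier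
  have h1 : ∀ z, LinearMap.lTensor L.carrier (α.toLin ∘ₗ LinearMap.fst K A.carrier B.carrier) z =
      L.tensorMap α (e z).1 := by
    intro z
    induction z using TensorProduct.induction_on with
    | zero => simp
    | add s t hs ht => rw [map_add, map_add, hs, ht, Prod.fst_add, map_add]
    | tmul x a => simp [e, tensorMap]
  have h2 : ∀ z, LinearMap.lTensor L.carrier (β.toLin ∘ₗ LinearMap.snd K A.carrier B.carrier) z =
      L.tensorMap β (e z).2 := by
    intro z
    induction z using TensorProduct.induction_on with
    | zero => simp
    | add s t hs ht => rw [map_add, map_add, hs, ht, Prod.snd_add, map_add]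
    | tmul x a => simp [e, tensorMap]
  have hmem : e.symm (x, y) ∈ LinearMap.eqLocus
      (AlgebraTensorModule.lTensor K L.carrier (α.toLin ∘ₗ LinearMap.fst K A.carrier B.carrier))
      (AlgebraTensorModule.lTensor K L.carrier
        (β.toLin ∘ₗ LinearMap.snd K A.carrier B.carrier)) := by
    change LinearMap.lTensor L.carrier _ _ = LinearMap.lTensor L.carrier _ _
    rw [h1, h2, e.apply_symm_apply]
    exact h
  rw [Module.Flat.eqLocus_lTensor_eq] at hmem
  obtain ⟨t, ht⟩ := hmem
  change L.carrier ⊗[K] (NilpDGA.fiberProd α β).carrier at t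
  have ht' : fiberIncl α β t = e.symm (x, y) := ht
  have hp := prodRight_fiberIncl (L := L) t
  rw [ht', LinearEquiv.apply_symm_apply] at hp
  have hp1 : x = L.tensorMap (NilpDGA.fiberFst α β) t := congrArg Prod.fst hp
  have hp2 : y = L.tensorMap (NilpDGA.fiberSnd α β) t := congrArg Prod.snd hp
  refine ⟨(L.tensor (NilpDGA.fiberProd α β)).toDGSpace.proj n t,
    (L.tensor (NilpDGA.fiberProd α β)).toDGSpace.proj_mem n t, ?_, ?_⟩
  · rw [tensorMap_proj, ← hp1, (L.tensor A).toDGSpace.proj_same hx]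
  · rw [tensorMap_proj, ← hp2, (L.tensor B).toDGSpace.proj_same hy]

end fiber

/-- If `I` is acyclic, then so is `L ⊗ I`. -/
theorem exists_tensor_d_eq {I : NilpDGA.{u, w} K} (hI : I.toDGSpace.Acyclic) {n : ℤ}
    {t : (L.tensor I).carrier} (ht : t ∈ (L.tensor I).gr n) (hd : (L.tensor I).d t = 0) :
    ∃ s ∈ (L.tensor I).gr (n - 1), (L.tensor I).d s = t := by
  obtain ⟨σ, hσ, hσd⟩ := hI.exists_contraction
  -- the sign in the contraction `x ⊗ a ↦ (-1) ^ i • x ⊗ σ a` is that of the differential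
  let S : L.carrier ⊗[K] I.carrier →ₗ[K] L.carrier ⊗[K] I.carrier :=
    TensorProduct.map L.toDGSpace.parity σ
  have hS : ∀ t : L.carrier ⊗[K] I.carrier, tensorD L I (S t) + S (tensorD L I t) = t := by
    intro t
    induction t using TensorProduct.induction_on with
    | zero => simp
    | add s t hs ht =>
      simp only [map_add]
      rw [add_add_add_comm, hs, ht]
    | tmul x a =>
      simp only [S, tensorD, LinearMap.add_apply, TensorProduct.map_tmul, map_add,
        LinearMap.id_apply, DGSpace.parity_parity, DGSpace.d_parity, TensorProduct.neg_tmul]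
      conv_rhs => rw [← hσd a, TensorProduct.tmul_add]
      abel
  refine ⟨S t, ?_, ?_⟩
  · refine tensorGr_induction (p := fun t => S t ∈ (L.tensor I).gr (n - 1)) ?_
      (by rw [map_zero]; exact zero_mem _)
      (fun s t hs ht => by rw [map_add]; exact add_mem hs ht)
      (fun c t ht => by rw [map_smul]; exact Submodule.smul_mem _ c ht) ht
    intro i j x a hij hx ha
    rw [show S (x ⊗ₜ[K] a) = L.toDGSpace.parity x ⊗ₜ[K] σ a from rfl, L.toDGSpace.parity_of_mem hx]
    exact tmul_mem_tensorGr (Submodule.smul_mem _ _ hx) (hσ j a ha) (by omega)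
  · have := hS t
    rwa [show tensorD L I t = 0 from hd, map_zero, add_zero] at this

section abelian

theorem bracket_eq_zero_of_trivialMul (hC : C.TrivialMul) (s t : (L.tensor C).carrier) :
    (L.tensor C).bracket s t = 0 := by
  change tensorBracket L C s t = 0
  change L.carrier ⊗[K] C.carrier at s t
  induction s using TensorProduct.induction_on with
  | zero => simp
  | add s s' h h' => rw [map_add, LinearMap.add_apply, h, h', add_zero]
  | tmul x a =>
    induction t using TensorProduct.induction_on with
    | zero => simp
    | add s s' h h' => rw [map_add, h, h', add_zero]
    | tmul y b => simp [tensorBracket_tmul_any, hC _ _]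

theorem gauge_of_trivialMul (hC : C.TrivialMul) (a w : (L.tensor C).carrier) :
    (L.tensor C).gauge a w = w - (L.tensor C).d a := by
  rw [gauge, finsum_eq_single _ 0]
  · simp [bracket_eq_zero_of_trivialMul hC, sub_eq_add_neg]
  · intro n hn
    obtain ⟨m, rfl⟩ := Nat.exists_eq_succ_of_ne_zero hn
    rw [Nat.succ_eq_add_one, pow_succ', Module.End.mul_apply, bracket_eq_zero_of_trivialMul hC,
      smul_zero]

theorem mem_MC_of_trivialMul (hC : C.TrivialMul) {w : (L.tensor C).carrier} :
    w ∈ (L.tensor C).MC ↔ w ∈ (L.tensor C).gr 1 ∧ (L.tensor C).d w = 0 := by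
  refine and_congr_right fun _ => ?_
  rw [bracket_eq_zero_of_trivialMul hC, smul_zero, add_zero]

end abelian

section flow

variable [CharZero K]

/-- Exponentials are natural in the algebra. -/
theorem tensorMap_flow (f : A ⟶ B) (a : (L.tensor A).carrier) (p : (L.tensor A).carrier × K) :
    (L.tensorMap f).prodMap LinearMap.id ((L.tensor A).flow a p) =
      (L.tensor B).flow (L.tensorMap f a) ((L.tensorMap f).prodMap LinearMap.id p) := by
  have := Module.End.commute_exp_left_of_commute
    ((nilpFiltration_tensorPow L A).isNilpotent_affAd a)
    ((nilpFiltration_tensorPow L B).isNilpotent_affAd (L.tensorMap f a))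
    (g := (L.tensorMap f).prodMap LinearMap.id) (by
      refine LinearMap.ext fun p => Prod.ext ?_ rfl
      change (L.tensor B).bracket _ _ - _ = L.tensorMap f (_ - _)
      rw [map_sub, map_smul, tensorMap_d, tensorMap_bracket]
      rfl)
  exact (LinearMap.congr_fun this p).symm

theorem tensorMap_flow_prod (f : A ⟶ B) (l : List (L.tensor A).carrier)
    {x y : (L.tensor A).carrier} (h : (l.map (L.tensor A).flow).prod (x, 1) = (y, 1)) :
    ((l.map (L.tensorMap f)).map (L.tensor B).flow).prod (L.tensorMap f x, 1) =
      (L.tensorMap f y, 1) := by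
  have key : ∀ (l : List (L.tensor A).carrier) (p : (L.tensor A).carrier × K),
      ((l.map (L.tensorMap f)).map (L.tensor B).flow).prod
        ((L.tensorMap f).prodMap LinearMap.id p) =
      (L.tensorMap f).prodMap LinearMap.id ((l.map (L.tensor A).flow).prod p) := by
    intro l p
    induction l with
    | nil => rfl
    | cons a l ih =>
      simp only [List.map_cons, List.prod_cons, Module.End.mul_apply]
      rw [ih, tensorMap_flow]
  have := key l (x, 1)
  rw [h] at this
  exact this

theorem flow_prod_of_trivialMul (hC : C.TrivialMul) (l : List (L.tensor C).carrier)
    (w : (L.tensor C).carrier) :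
    (l.map (L.tensor C).flow).prod (w, 1) = (w - (L.tensor C).d l.sum, 1) := by
  induction l with
  | nil => simp
  | cons a l ih =>
    rw [List.map_cons, List.prod_cons, Module.End.mul_apply, ih,
      flow_apply_one (nilpFiltration_tensorPow L C), gauge_of_trivialMul hC, List.sum_cons, map_add]
    refine Prod.ext ?_ rfl
    change _ - _ - _ = _ - (_ + _)
    abel

end flow

end DGLA

/-! ### `Def_L` is a deformation functor -/

namespace DGLA

open NilpDGA

variable {K : Type u} [Field K] {L : DGLA.{u, v} K} {A B C : NilpDGA.{u, w} K}

theorem tensorMap_fiber {α : A ⟶ C} {β : B ⟶ C} (t : (L.tensor (fiberProd α β)).carrier) :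
    L.tensorMap α (L.tensorMap (fiberFst α β) t) =
      L.tensorMap β (L.tensorMap (fiberSnd α β) t) := by
  rw [← tensorMap_comp, ← tensorMap_comp, fiber_condition]

/-- `MC(L ⊗ (A ×_C B)) = MC(L ⊗ A) ×_{MC(L ⊗ C)} MC(L ⊗ B)`. -/
theorem exists_fiber_MC {α : A ⟶ C} {β : B ⟶ C} (x : (L.tensor A).MC) (y : (L.tensor B).MC)
    (h : L.tensorMap α x = L.tensorMap β y) :
    ∃ z : (L.tensor (fiberProd α β)).MC,
      L.mcMap (fiberFst α β) z = x ∧ L.mcMap (fiberSnd α β) z = y := by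
  obtain ⟨z, hz, hzx, hzy⟩ := exists_fiber_tensor x.2.1 y.2.1 h
  refine ⟨⟨z, hz, fiber_tensor_ext ?_ ?_⟩, Subtype.ext hzx, Subtype.ext hzy⟩
  · rw [map_add, map_smul, tensorMap_bracket, tensorMap_d, hzx, map_zero]
    exact x.2.2
  · rw [map_add, map_smul, tensorMap_bracket, tensorMap_d, hzy, map_zero]
    exact y.2.2

/-- For acyclic `I` with trivial multiplication, every Maurer-Cartan element is a coboundary, hence
gauge equivalent to zero. -/
theorem Def_unique_of_acyclic [CharZero K] {I : NilpDGA.{u, w} K} (hI : I.TrivialMul)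
    (hI' : I.toDGSpace.Acyclic) : Nonempty (Unique ((DGLA.Def.{u, v, w} L).obj I)) := by
  have h0 : (0 : (L.tensor I).carrier) ∈ (L.tensor I).MC :=
    (mem_MC_of_trivialMul hI).2 ⟨zero_mem _, map_zero _⟩
  refine ⟨⟨⟨Quot.mk _ ⟨0, h0⟩⟩, fun x => ?_⟩⟩
  induction x using Quot.ind with
  | mk x =>
    obtain ⟨hx1, hx⟩ := (mem_MC_of_trivialMul hI).1 x.2
    obtain ⟨s, hs, hsx⟩ := exists_tensor_d_eq hI' hx1 hx
    refine Quot.sound ⟨s, hs, ?_⟩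
    rw [gauge_of_trivialMul hI, hsx, sub_self]

theorem exists_list_tensorMap_eq {f : A ⟶ B} (hf : Function.Surjective f.toLin)
    (l : List (L.tensor B).carrier) (hl : ∀ b ∈ l, b ∈ (L.tensor B).gr 0) :
    ∃ l' : List (L.tensor A).carrier, (∀ a ∈ l', a ∈ (L.tensor A).gr 0) ∧
      l'.map (L.tensorMap f) = l := by
  induction l with
  | nil => exact ⟨[], by simp, rfl⟩
  | cons b l ih =>
    obtain ⟨l', hl', rfl⟩ := ih fun c hc => hl c (List.mem_cons_of_mem b hc)
    obtain ⟨a, ha, rfl⟩ := exists_tensorMap_eq hf (hl b List.mem_cons_self)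
    exact ⟨a :: l', by simpa [ha] using hl', rfl⟩

theorem fiberSnd_surjective {α : A ⟶ C} (β : B ⟶ C) (hα : Function.Surjective α.toLin) :
    Function.Surjective (fiberSnd α β).toLin := fun b => by
  obtain ⟨a, ha⟩ := hα (β.toLin b)
  exact ⟨⟨(a, b), ha⟩, rfl⟩

theorem Def_fiberComparison_surjective [CharZero K] (α : A ⟶ C) (β : B ⟶ C)
    (hα : Function.Surjective α.toLin) :
    Function.Surjective (fiberComparison (DGLA.Def.{u, v, w} L) α β) := by
  rintro ⟨⟨x, y⟩, h⟩
  induction x using Quot.ind with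
  | mk x =>
  induction y using Quot.ind with
  | mk y =>
  obtain ⟨l, hl, hxy⟩ := (mk_eq_mk_iff (nilpFiltration_tensorPow L C) _ _).1 h
  -- the gauge equivalence of `α x` and `β y` is lifted to `x`
  obtain ⟨l', hl', rfl⟩ := exists_list_tensorMap_eq hα l hl
  obtain ⟨x', hx', hxx'⟩ := flow_prod_mem_MC (nilpFiltration_tensorPow L A) l' hl' x.2
  have h1 : L.tensorMap α x'.1 = L.tensorMap β y.1 :=
    congrArg Prod.fst ((tensorMap_flow_prod α l' hx').symm.trans hxy)
  obtain ⟨z, hz1, hz2⟩ := exists_fiber_MC x' y h1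
  refine ⟨Quot.mk _ z, Subtype.ext (Prod.ext ?_ ?_)⟩
  · change Quot.mk _ (L.mcMap (fiberFst α β) z) = _
    rw [hz1]
    exact hxx'.symm
  · change Quot.mk _ (L.mcMap (fiberSnd α β) z) = _
    rw [hz2]

/-- If two Maurer-Cartan elements of `L ⊗ (A ×_C B)` have the same second component, and their
first components are related by a product of exponentials with sum in `L ⊗ ker α`, then they are
gauge equivalent. -/
theorem mk_eq_mk_of_fiberFst [CharZero K] {α : A ⟶ C} {β : B ⟶ C} (hC : C.TrivialMul)
    (z z' : (L.tensor (fiberProd α β)).MC)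
    (hsnd : L.tensorMap (fiberSnd α β) z.1 = L.tensorMap (fiberSnd α β) z'.1)
    (l : List (L.tensor A).carrier) (hl : ∀ a ∈ l, a ∈ (L.tensor A).gr 0)
    (hsum : L.tensorMap α l.sum = 0)
    (h : (l.map (L.tensor A).flow).prod (L.tensorMap (fiberFst α β) z.1, 1) =
      (L.tensorMap (fiberFst α β) z'.1, 1)) :
    (Quot.mk (L.tensor (fiberProd α β)).GaugeEquiv z : Quot _) = Quot.mk _ z' := by
  obtain ⟨l', hl', hll'⟩ := exists_flow_prod_eq_of_sum_mem (nilpFiltration_tensorPow L A)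
    ((L.tensor A).gr 0 ⊓ LinearMap.ker (L.tensorMap α)) inf_le_left
    (fun a ha b hb => ⟨(L.tensor A).bracket_mem_gr_zero ha hb, by
      change L.tensorMap α _ = 0
      rw [tensorMap_bracket, bracket_eq_zero_of_trivialMul hC]⟩) l hl
    ⟨list_sum_mem hl, hsum⟩
  -- the elements `a` of `L ⊗ ker α` are lifted to the elements `(a, 0)`
  have hlift : ∀ l' : List (L.tensor A).carrier,
      (∀ a ∈ l', a ∈ (L.tensor A).gr 0 ⊓ LinearMap.ker (L.tensorMap α)) →
      ∃ l'' : List (L.tensor (fiberProd α β)).carrier,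
        (∀ a ∈ l'', a ∈ (L.tensor (fiberProd α β)).gr 0) ∧
        l''.map (L.tensorMap (fiberFst α β)) = l' ∧
        ((l''.map (L.tensorMap (fiberSnd α β))).map (L.tensor B).flow).prod = 1 := by
    intro l'
    induction l' with
    | nil => exact fun _ => ⟨[], by simp, rfl, rfl⟩
    | cons a l' ih =>
      intro hl'
      obtain ⟨l'', h1, rfl, h2⟩ := ih fun b hb => hl' b (List.mem_cons_of_mem a hb)
      have ha := hl' a List.mem_cons_self
      obtain ⟨t, ht, rfl, ht2⟩ := exists_fiber_tensor (α := α) (β := β) ha.1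
        (zero_mem ((L.tensor B).gr 0)) (by rw [map_zero]; exact ha.2)
      refine ⟨t :: l'', by simpa [ht] using h1, rfl, ?_⟩
      rw [List.map_cons, List.map_cons, List.prod_cons, h2, ht2, flow_zero, mul_one]
  obtain ⟨l'', hl'', rfl, h0⟩ := hlift l' hl'
  obtain ⟨w, hw, hzw⟩ := flow_prod_mem_MC (nilpFiltration_tensorPow L (fiberProd α β)) l'' hl'' z.2
  have h1 := tensorMap_flow_prod (fiberFst α β) l'' hw
  have h2 := tensorMap_flow_prod (fiberSnd α β) l'' hw
  rw [← hll', h] at h1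
  rw [h0, Module.End.one_apply] at h2
  have : z' = w := Subtype.ext (fiber_tensor_ext (congrArg Prod.fst h1)
    (hsnd.symm.trans (congrArg Prod.fst h2)))
  rw [this]
  exact hzw

theorem map_list_sum_tensorMap (f : A ⟶ B) (l : List (L.tensor A).carrier) :
    (l.map (L.tensorMap f)).sum = L.tensorMap f l.sum := (map_list_sum _ _).symm

/-- The map `η` is injective if `C` is an acyclic complex with trivial multiplication. -/
theorem Def_fiberComparison_injective [CharZero K] (α : A ⟶ C) (β : B ⟶ C)
    (hα : Function.Surjective α.toLin) (hC : C.TrivialMul) (hC' : C.toDGSpace.Acyclic) :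
    Function.Injective (fiberComparison (DGLA.Def.{u, v, w} L) α β) := by
  intro z z' h
  induction z using Quot.ind with
  | mk z =>
  induction z' using Quot.ind with
  | mk z' =>
  have h := Prod.ext_iff.1 (Subtype.ext_iff.1 h)
  have hTA := nilpFiltration_tensorPow L A
  obtain ⟨lA, hlA, hA⟩ := (mk_eq_mk_iff hTA _ _).1 h.1
  obtain ⟨lB, hlB, hB⟩ := (mk_eq_mk_iff (nilpFiltration_tensorPow L B) _ _).1 h.2
  change (lA.map (L.tensor A).flow).prod (L.tensorMap (fiberFst α β) z, 1) =
    (L.tensorMap (fiberFst α β) z', 1) at hA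
  change (lB.map (L.tensor B).flow).prod (L.tensorMap (fiberSnd α β) z, 1) =
    (L.tensorMap (fiberSnd α β) z', 1) at hB
  have hxMC : L.tensorMap (fiberFst α β) z ∈ (L.tensor A).MC := (L.mcMap (fiberFst α β) z).2
  -- the two equivalences differ in `L ⊗ C` by a cocycle, hence by a coboundary
  have hdA := congrArg Prod.fst (tensorMap_flow_prod α lA hA)
  have hdB := congrArg Prod.fst (tensorMap_flow_prod β lB hB)
  rw [flow_prod_of_trivialMul hC, map_list_sum_tensorMap] at hdA hdB
  have hd : (L.tensor C).d (L.tensorMap α lA.sum - L.tensorMap β lB.sum) = 0 := by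
    change L.tensorMap α _ - (L.tensor C).d _ = L.tensorMap α _ at hdA
    change L.tensorMap β _ - (L.tensor C).d _ = L.tensorMap β _ at hdB
    rw [tensorMap_fiber, tensorMap_fiber, ← hdB] at hdA
    rw [map_sub, sub_eq_zero]
    exact sub_right_injective hdA
  obtain ⟨e', he', hec⟩ := exists_tensor_d_eq hC' (n := 0)
    (sub_mem (L.tensorMap_gr α (list_sum_mem hlA)) (L.tensorMap_gr β (list_sum_mem hlB))) hd
  -- this coboundary is the image of an element of the stabilizer of the first component of `z`
  obtain ⟨e, he, rfl⟩ := exists_tensorMap_eq hα he'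
  rw [zero_sub] at he
  have hax := flow_neg_stabilizer hTA hxMC he
  obtain ⟨a, ha⟩ : ∃ a, a = (L.tensor A).d e +
    (L.tensor A).bracket (L.tensorMap (fiberFst α β) z) e := ⟨_, rfl⟩
  rw [← ha] at hax
  have haA : a ∈ (L.tensor A).gr 0 := by
    rw [ha]
    exact stabilizer_mem hxMC he
  have haα : L.tensorMap α a = L.tensorMap α lA.sum - L.tensorMap β lB.sum := by
    rw [ha, map_add, tensorMap_bracket, bracket_eq_zero_of_trivialMul hC, add_zero, tensorMap_d,
      hec]
  -- the equivalence of the second components is lifted to the fibre product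
  obtain ⟨lP, hlP, rfl⟩ := exists_list_tensorMap_eq (fiberSnd_surjective β hα) lB hlB
  obtain ⟨w, hw, hzw⟩ := flow_prod_mem_MC (nilpFiltration_tensorPow L (fiberProd α β)) lP hlP z.2
  have h1 := tensorMap_flow_prod (fiberFst α β) lP hw
  have h2 := tensorMap_flow_prod (fiberSnd α β) lP hw
  set lP' := lP.map (L.tensorMap (fiberFst α β)) with hlP'
  have hlP'0 : ∀ b ∈ lP', b ∈ (L.tensor A).gr 0 := by
    intro b hb
    obtain ⟨c, hc, rfl⟩ := List.mem_map.1 hb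
    exact L.tensorMap_gr _ (hlP c hc)
  refine hzw.trans (mk_eq_mk_of_fiberFst hC w z'
    (congrArg Prod.fst (h2.symm.trans hB)) (lA ++ -a :: (lP'.map Neg.neg).reverse) ?_ ?_ ?_)
  · intro b hb
    rcases List.mem_append.1 hb with hb | hb
    · exact hlA b hb
    rcases List.mem_cons.1 hb with rfl | hb
    · exact neg_mem haA
    · exact neg_mem_of_mem_map_neg_reverse hlP'0 b hb
  · have h3 : (lP'.map Neg.neg).reverse.sum = -lP'.sum := by
      rw [List.sum_reverse, ← List.sum_neg]
    have h4 : L.tensorMap α lP'.sum =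
        L.tensorMap β (lP.map (L.tensorMap (fiberSnd α β))).sum := by
      rw [hlP', map_list_sum_tensorMap, map_list_sum_tensorMap, tensorMap_fiber]
    rw [List.sum_append, List.sum_cons, h3, map_add, map_add, map_neg, map_neg, haα, h4]
    abel
  · rw [List.map_append, List.prod_append, List.map_cons, List.prod_cons, Module.End.mul_apply,
      Module.End.mul_apply, ← h1, flow_prod_neg_reverse_apply hTA, hax, hA]

/-- For a small extension `A → B` with kernel `I = A ×_B 0`, the bracket of `L ⊗ A` vanishes on
`L ⊗ I`. -/
theorem bracket_fiberFst_eq_zero {α : A ⟶ B} (hα : IsSmallExtension α) (s : (L.tensor A).carrier)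
    (t : (L.tensor (fiberProd α (zeroHom (NilpDGA.zero K) B))).carrier) :
    (L.tensor A).bracket s (L.tensorMap (fiberFst α (zeroHom (NilpDGA.zero K) B)) t) = 0 := by
  change tensorBracket L A s _ = 0
  change L.carrier ⊗[K] A.carrier at s
  change L.carrier ⊗[K] (fiberProd α (zeroHom (NilpDGA.zero K) B)).carrier at t
  induction t using TensorProduct.induction_on with
  | zero => rw [map_zero, map_zero]
  | add t t' h h' => rw [map_add, map_add, h, h', add_zero]
  | tmul y b =>
    rw [tensorMap_tmul]
    have hb : α.toLin ((fiberFst α (zeroHom (NilpDGA.zero K) B)).toLin b) = 0 := b.2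
    induction s using TensorProduct.induction_on with
    | zero => rw [map_zero, LinearMap.zero_apply]
    | add s s' h h' => rw [map_add, LinearMap.add_apply, h, h', add_zero]
    | tmul x a =>
      rw [tensorBracket_tmul_any, hα.annihilates _ _ hb, hα.annihilates _ _ hb]
      simp

/-- Maurer-Cartan elements lift along acyclic small extensions. -/
theorem Def_lift [CharZero K] (α : A ⟶ B) (hα : IsAcyclicSmallExtension α) :
    Function.Surjective ((DGLA.Def.{u, v, w} L).map α) := by
  intro y
  induction y using Quot.ind with
  | mk y =>
  obtain ⟨x, hx, hxy⟩ := exists_tensorMap_eq hα.surjective y.2.1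
  -- the kernel of `α`, as an algebra
  set I := fiberProd α (zeroHom (NilpDGA.zero K) B) with hI
  set ι : I ⟶ A := fiberFst α (zeroHom (NilpDGA.zero K) B) with hι
  have hz : ∀ s : (L.tensor (NilpDGA.zero K)).carrier,
      L.tensorMap (zeroHom (NilpDGA.zero K) B) s = 0 := fun s => by
    change TensorProduct.map _ (0 : _ →ₗ[K] _) s = 0
    rw [TensorProduct.map_zero_right, LinearMap.zero_apply]
  have hIac : I.toDGSpace.Acyclic := by
    intro t ht
    obtain ⟨b, hb, hbt⟩ := hα.acyclic t.1.1 t.2 (congrArg (fun s => s.1.1) ht)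
    exact ⟨⟨(b, 0), hb⟩, Subtype.ext (Prod.ext hbt rfl)⟩
  have hαι : ∀ t, L.tensorMap α (L.tensorMap ι t) = 0 := fun t => by
    rw [hι, tensorMap_fiber, hz]
  have hι0 : ∀ t, L.tensorMap ι t = 0 → t = 0 := by
    intro t ht
    refine fiber_tensor_ext (ht.trans (map_zero _).symm) ?_
    have : Subsingleton (L.carrier ⊗[K] PUnit.{w + 1}) := inferInstance
    exact this.elim _ _
  have hbr : ∀ s t, (L.tensor A).bracket s (L.tensorMap ι t) = 0 :=
    bracket_fiberFst_eq_zero hα.toIsSmallExtension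
  -- the curvature of the lift `x` is a cocycle of `L ⊗ ker α`
  set c := (L.tensor A).d x + (1 / 2 : K) • (L.tensor A).bracket x x with hc
  have hcgr : c ∈ (L.tensor A).gr (1 + 1) := add_mem ((L.tensor A).d_mem hx)
    (Submodule.smul_mem _ _ ((L.tensor A).bracket_mem hx hx))
  have hcα : L.tensorMap α c = 0 := by
    rw [hc, map_add, map_smul, tensorMap_d, tensorMap_bracket, hxy]
    exact y.2.2
  obtain ⟨t, ht, htc, -⟩ := exists_fiber_tensor (α := α) (β := zeroHom (NilpDGA.zero K) B) hcgr
    (zero_mem ((L.tensor (NilpDGA.zero K)).gr (1 + 1))) (by rw [hcα, hz])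
  change L.tensorMap ι t = c at htc
  have hdx : (L.tensor A).d x = c - (1 / 2 : K) • (L.tensor A).bracket x x := by
    rw [hc, add_sub_cancel_right]
  have hxdx : (L.tensor A).bracket x ((L.tensor A).d x) = 0 := by
    rw [hdx, map_sub, map_smul, (L.tensor A).bracket_bracket_self hx, ← htc, hbr, smul_zero,
      sub_zero]
  have hdxx : (L.tensor A).bracket ((L.tensor A).d x) x = 0 := by
    have := (L.tensor A).skew hx ((L.tensor A).d_mem hx)
    rw [hxdx, zero_add] at this
    exact (smul_eq_zero_iff_right (zpow_ne_zero _ (by simp))).1 this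
  have hdt : (L.tensor I).d t = 0 := by
    refine hι0 _ ?_
    rw [tensorMap_d, htc, hc, map_add, map_smul, (L.tensor A).d_d, (L.tensor A).leibniz hx hx,
      hxdx, hdxx]
    simp
  obtain ⟨s, hs, hst⟩ := exists_tensor_d_eq hIac ht hdt
  rw [show (1 + 1 - 1 : ℤ) = 1 by norm_num] at hs
  have hs1 := L.tensorMap_gr ι hs
  refine ⟨Quot.mk _ ⟨x - L.tensorMap ι s, sub_mem hx hs1, ?_⟩, congrArg (Quot.mk _)
    (Subtype.ext ?_)⟩
  · have h1 := hbr x s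
    have h2 : (L.tensor A).bracket (L.tensorMap ι s) x = 0 := by
      rw [(L.tensor A).bracket_comm_of_gr_one hs1 hx, h1]
    rw [map_sub, map_sub, map_sub, LinearMap.sub_apply, LinearMap.sub_apply, h1, h2, hbr,
      ← tensorMap_d, hst, htc, hdx]
    simp
  · change L.tensorMap α (x - L.tensorMap ι s) = y.1
    rw [map_sub, hαι, sub_zero, hxy]

theorem Def_isDeformationFunctor [CharZero K] (L : DGLA.{u, v} K) :
    IsDeformationFunctor (DGLA.Def.{u, v, w} L) where
  map_zero := Def_unique_of_acyclic zero_trivialMul zero_acyclic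
  surjective := Def_fiberComparison_surjective
  bijective α β hα hC hC' := ⟨Def_fiberComparison_injective α β hα hC hC',
    Def_fiberComparison_surjective α β hα⟩
  lift := Def_lift
  acyclic _ := Def_unique_of_acyclic

end DGLA

/-! ### The tangent spaces of `Def_L` -/

namespace NilpDGA

theorem omega_acyclic {K : Type u} [Field K] (n : ℤ) : (omega K n).toDGSpace.Acyclic := by
  rintro ⟨a, b⟩ h
  change (-1 : K) ^ n • ((0 : K), a) = 0 at h
  have hn : (-1 : K) ^ n ≠ 0 := zpow_ne_zero _ (by simp)
  have ha : a = 0 := (smul_eq_zero_iff_right hn).1 (congrArg Prod.snd h)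
  refine ⟨(((-1 : K) ^ n)⁻¹ • b, 0), ?_⟩
  change (-1 : K) ^ n • ((0 : K), ((-1 : K) ^ n)⁻¹ • b) = (a, b)
  rw [Prod.smul_mk, smul_zero, smul_smul, mul_inv_cancel₀ hn, one_smul, ha]

end NilpDGA

namespace DGLA

open NilpDGA

variable {K : Type u} [Field K]

section shift

variable {L : DGLA.{u, v} K} {n : ℤ}

/-- The isomorphism `L ⊗ K[n] ≅ L`, of degree `n`. -/
noncomputable def shiftEquiv (L : DGLA.{u, v} K) (n : ℤ) :
    (L.tensor (shiftK K n)).carrier ≃ₗ[K] L.carrier :=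
  TensorProduct.rid K L.carrier

theorem shiftEquiv_d (t : (L.tensor (shiftK K n)).carrier) :
    shiftEquiv L n ((L.tensor (shiftK K n)).d t) = L.d (shiftEquiv L n t) := by
  obtain ⟨x, rfl⟩ := (shiftEquiv L n).symm.surjective t
  rw [LinearEquiv.apply_symm_apply, ← LinearEquiv.eq_symm_apply]
  change tensorD L (shiftK K n) (x ⊗ₜ[K] shiftOne K n) = L.d x ⊗ₜ[K] shiftOne K n
  rw [tensorD, LinearMap.add_apply, TensorProduct.map_tmul, TensorProduct.map_tmul,
    show (shiftK K n).d = 0 from rfl, LinearMap.zero_apply, TensorProduct.tmul_zero, add_zero]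
  rfl

theorem shiftEquiv_symm_mem {m : ℤ} {x : L.carrier} (hx : x ∈ L.gr (m + n)) :
    (shiftEquiv L n).symm x ∈ (L.tensor (shiftK K n)).gr m :=
  tmul_mem_tensorGr hx (shiftOne_mem n) (by omega)

theorem shiftEquiv_mem {m : ℤ} {t : (L.tensor (shiftK K n)).carrier}
    (ht : t ∈ (L.tensor (shiftK K n)).gr m) : shiftEquiv L n t ∈ L.gr (m + n) := by
  refine tensorGr_induction (p := fun t => shiftEquiv L n t ∈ L.gr (m + n)) ?_
    (by rw [map_zero]; exact zero_mem _)
    (fun s t hs ht => by rw [map_add]; exact add_mem hs ht)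
    (fun c t ht => by rw [map_smul]; exact Submodule.smul_mem _ c ht) ht
  intro i j x a hij hx ha
  have h : shiftEquiv L n (x ⊗ₜ[K] a) = (show K from a) • x := TensorProduct.rid_tmul _ _
  rw [h]
  by_cases hj : j = -n
  · rw [show m + n = i by omega]
    exact Submodule.smul_mem _ _ hx
  · rw [show (show K from a) = 0 from eq_zero_of_mem_lineGr hj ha, zero_smul]
    exact zero_mem _

end shift

section linear

variable {L : DGLA.{u, v} K} {A : NilpDGA.{u, w} K}
  (h : IsPredeformationFunctor (DGLA.Def.{u, v, w} L)) (hA : A.TrivialMul)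

/-- The class in the vector space `Def_L(A)` of a Maurer-Cartan element. -/
noncomputable def vecMk (x : (L.tensor A).MC) : h.Vec A hA :=
  (Quot.mk (L.tensor A).GaugeEquiv x : (DGLA.Def.{u, v, w} L).obj A)

theorem ev_mk {B : NilpDGA.{u, w} K} (f : B ⟶ A) (x : (L.tensor B).MC) :
    h.ev hA f (Quot.mk (L.tensor B).GaugeEquiv x : (DGLA.Def.{u, v, w} L).obj B) =
      vecMk h hA (L.mcMap f x) := rfl

/-- The sum in `Def_L(A)` is induced by the sum of Maurer-Cartan elements. -/
theorem vecMk_add [CharZero K] (x y s : (L.tensor A).MC) (hs : s.1 = x.1 + y.1) :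
    vecMk h hA s = vecMk h hA x + vecMk h hA y := by
  obtain ⟨z, rfl, rfl⟩ := exists_fiber_MC (α := zeroHom A (NilpDGA.zero K))
    (β := zeroHom A (NilpDGA.zero K)) x y (by
      have : Subsingleton (L.carrier ⊗[K] PUnit.{w + 1}) := inferInstance
      exact this.elim _ _)
  have h1 := h.ev_add hA (prodFst A A) (prodSnd A A)
    (Quot.mk (L.tensor (prod A A)).GaugeEquiv z : (DGLA.Def.{u, v, w} L).obj (prod A A))
  rw [ev_mk, ev_mk, ev_mk] at h1
  rw [h1]
  refine congrArg (vecMk h hA) (Subtype.ext (hs.trans ?_))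
  change TensorProduct.map _ _ _ + TensorProduct.map _ _ _ = TensorProduct.map _ (_ + _) _
  rw [TensorProduct.map_add_right]
  rfl

/-- The scalar multiplication in `Def_L(A)` is induced by that of Maurer-Cartan elements. -/
theorem vecMk_smul (c : K) (x s : (L.tensor A).MC) (hs : s.1 = c • x.1) :
    vecMk h hA s = c • vecMk h hA x := by
  have h1 : c • vecMk h hA x = vecMk h hA (L.mcMap (smulHom hA c (𝟙 A)) x) := rfl
  rw [h1]
  refine congrArg (vecMk h hA) (Subtype.ext (hs.trans ?_))
  change _ = TensorProduct.map LinearMap.id (c • LinearMap.id) _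
  rw [TensorProduct.map_smul_right, TensorProduct.map_id]
  rfl

end linear

section tangent

variable (L : DGLA.{u, v} K) (h : IsDeformationFunctor (DGLA.Def.{u, v, u} L)) (i : ℤ)

/-- The linear map `Z^i(L) → Def_L(K[i - 1])` which maps `x` to the class of `x ⊗ 1[i - 1]`. -/
noncomputable def cocycleVec [CharZero K] : L.toDGSpace.cocycles i →ₗ[K]
    h.toIsPredeformationFunctor.Vec (shiftK K (i - 1)) (shiftK_trivialMul (i - 1)) where
  toFun x := vecMk h.toIsPredeformationFunctor (shiftK_trivialMul (i - 1)) (L.cocycleMC x)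
  map_add' _ _ := vecMk_add _ _ _ _ _ (TensorProduct.add_tmul _ _ _)
  map_smul' _ _ := vecMk_smul _ _ _ _ _ (TensorProduct.smul_tmul' _ _ _).symm

theorem cocycleVec_surjective [CharZero K] : Function.Surjective (cocycleVec L h i) := by
  intro t
  obtain ⟨w, rfl⟩ := Quot.exists_rep (r := (L.tensor (shiftK K (i - 1))).GaugeEquiv) t
  obtain ⟨hw1, hw⟩ := (mem_MC_of_trivialMul (shiftK_trivialMul (i - 1))).1 w.2
  have h1 := shiftEquiv_mem hw1
  rw [add_sub_cancel] at h1
  refine ⟨⟨shiftEquiv L (i - 1) w.1, h1, ?_⟩, ?_⟩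
  · change L.d _ = 0
    rw [← shiftEquiv_d, hw, map_zero]
  · refine congrArg (Quot.mk _) (Subtype.ext ?_)
    exact (shiftEquiv L (i - 1)).symm_apply_apply w.1

/-- The elements `x ⊗ 1[i - 1]` which are gauge equivalent to zero are those with `x ∈ B^i(L)`. -/
theorem ker_cocycleVec [CharZero K] : LinearMap.ker (cocycleVec L h i) =
    (L.toDGSpace.coboundaries i).submoduleOf (L.toDGSpace.cocycles i) := by
  ext x
  have h0 : x ∈ LinearMap.ker (cocycleVec L h i) ↔
      (Quot.mk (L.tensor (shiftK K (i - 1))).GaugeEquiv (L.cocycleMC 0) : Quot _) =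
        Quot.mk _ (L.cocycleMC x) := by
    rw [LinearMap.mem_ker, ← map_zero (cocycleVec L h i), eq_comm]
    rfl
  have hz : (L.cocycleMC (0 : L.toDGSpace.cocycles i)).1 = 0 := TensorProduct.zero_tmul _ _
  have hx : (L.cocycleMC x).1 = (shiftEquiv L (i - 1)).symm x.1 := rfl
  rw [h0, mk_eq_mk_iff (nilpFiltration_tensorPow L _), hz, hx]
  simp only [flow_prod_of_trivialMul (shiftK_trivialMul (i - 1)), zero_sub]
  constructor
  · rintro ⟨l, hl, hlx⟩
    have h1 := shiftEquiv_mem (list_sum_mem hl)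
    rw [zero_add] at h1
    refine ⟨-shiftEquiv L (i - 1) l.sum, neg_mem h1, ?_⟩
    have h2 := congrArg (shiftEquiv L (i - 1)) (congrArg Prod.fst hlx)
    rw [map_neg, shiftEquiv_d, LinearEquiv.apply_symm_apply] at h2
    rw [map_neg, h2]
    rfl
  · rintro ⟨b, hb, hbx⟩
    change L.d b = x.1 at hbx
    refine ⟨[-(shiftEquiv L (i - 1)).symm b], ?_, ?_⟩
    · intro a ha
      rw [List.mem_singleton.1 ha]
      exact neg_mem (shiftEquiv_symm_mem (by rwa [zero_add]))
    · refine Prod.ext ((shiftEquiv L (i - 1)).injective ?_) rfl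
      rw [List.sum_singleton, map_neg, shiftEquiv_d, map_neg, map_neg, neg_neg,
        LinearEquiv.apply_symm_apply, LinearEquiv.apply_symm_apply, hbx]

/-- `T^i Def_L` is all of `Def_L(K[i - 1])`, since `Def_L(Ω[i - 1])` is a point. -/
theorem range_vecMap_omegaProj : LinearMap.range (h.toIsPredeformationFunctor.vecMap
    (omega_trivialMul (i - 1)) (shiftK_trivialMul (i - 1)) (omegaProj K (i - 1))) = ⊥ := by
  obtain ⟨hu⟩ := h.acyclic (omega K (i - 1)) (omega_trivialMul _) (omega_acyclic _)
  rw [LinearMap.range_eq_bot]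
  refine LinearMap.ext fun x => ?_
  have hx : x = 0 := (hu.uniq x).trans (hu.uniq _).symm
  rw [hx, map_zero, map_zero]

/-- The isomorphism `H^i(L) ≅ T^i Def_L`. -/
noncomputable def cohomologyEquivTangent [CharZero K] :
    L.toDGSpace.Cohomology i ≃ₗ[K] h.toIsPredeformationFunctor.Tangent i :=
  (Submodule.quotEquivOfEq _ _ (ker_cocycleVec L h i).symm).trans
    (((cocycleVec L h i).quotKerEquivOfSurjective (cocycleVec_surjective L h i)).trans
      (Submodule.quotEquivOfEqBot _ (range_vecMap_omegaProj L h i)).symm)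

theorem cohomologyEquivTangent_mk [CharZero K] (x : L.toDGSpace.cocycles i) :
    cohomologyEquivTangent L h i (Submodule.Quotient.mk x) =
      h.toIsPredeformationFunctor.tangentClass i (L.cocycleDef x) := rfl

end tangent

end DGLA

theorem mainTheorem6 {K : Type u} [Field K] [CharZero K] (L : DGLA.{u, v} K) :
    ∃ h : IsDeformationFunctor (DGLA.Def.{u, v, u} L), ∀ i : ℤ,
      ∃ e : h.toIsPredeformationFunctor.Tangent i ≃ₗ[K] L.toDGSpace.Cohomology i,
        ∀ x : L.toDGSpace.cocycles i,
          e (h.toIsPredeformationFunctor.tangentClass i (L.cocycleDef x)) =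
            Submodule.Quotient.mk x := by
  refine ⟨DGLA.Def_isDeformationFunctor L, fun i =>
    ⟨(DGLA.cohomologyEquivTangent L (DGLA.Def_isDeformationFunctor L) i).symm, fun x => ?_⟩⟩
  rw [LinearEquiv.symm_apply_eq, DGLA.cohomologyEquivTangent_mk]
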